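/- Let $(\Omega,\mathcal M,P)$ be a probability space, let $\sigma=\{\sigma_t\}_{t\ge 0}$ be a (jointly measurable) stochastic process with values in a measurable space $\mathcal S$, and let $R_1>0$ be a random variable which is a regeneration epoch of $\sigma$: the process $\{\sigma_{t+R_1}\}_{t\ge 0}$ is independent of $\{\{\sigma_t\}_{t<R_1},R_1\}$ and has the same law (finite-dimensional distributions) as $\{\sigma_t\}_{t\ge0}$. Let $\{A_s\}_{s\in\mathcal S}$ be a (measurable) family of real $n\times n$ matrices, and consider the regenerative switched linear system $$\Sigma:\quad \frac{dx}{dt}=A_{\sigma_t}x(t),\qquad x(0)=x_0\in\mathbb R^n ,$$ with deterministic initial state $x_0$ (solutions are understood in the integral sense). Let $m$ be a positive integer. For $x\in\mathbb R^n$ let $x^{[m]}$ be the vector of all monomials $\sqrt{m!/(\alpha_1!\cdots\alpha_n!)}\;x_1^{\alpha_1}\cdots x_n^{\alpha_n}$ with $\alpha\in\mathbb N^n$, $\alpha_1+\dots+\alpha_n=m$, and for $A\in\mathbb R^{n\times n}$ let $A^{[m]}$ be the unique matrix with $(Ax)^{[m]}=A^{[m]}x^{[m]}$ for all $x\in\mathbb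 R^n$. For each $\omega\in\Omega$ let $M_0(\omega)=\Phi(\omega;0,R_1(\omega))$, where $\frac{\partial}{\partial t}\Phi(\omega;0,t)=A_{\sigma_t(\omega)}\Phi(\omega;0,t)$ and $\Phi(\omega;0,0)=I$. Assume that - either $m$ is even, or $\Sigma$ is positive, i.e. $x_0\ge 0$ entrywise implies $x(t)\ge0$ entrywise with probability one for every $t\ge0$; - $R_1$ is essentially bounded; - the set $\{A_s\}_{s\in\mathcal S}$ is bounded. Then $M_0^{[m]}$ is integrable, and the following statements are equivalent. 1. $\Sigma$ is exponentially $m$th mean stable: there are $\alpha,\beta>0$ such that $E[\|x(t)\|^m]\le\alpha e^{-\beta t}\|x_0\|^m$ for all $x_0\in\mathbb R^n$ and $t\ge0$, where $\|\cdot\|$ is the Euclidean norm. 2. $\Sigma$ is stochastically $m$th mean stable: $\int_0^\infty E[\|x(t)\|^m]\,dt<\infty$ for every $x_0\in\mathbb R^n$. 3. $E[M_0^{[m]}]$ is Schur stable, i.e. its spectral radius is less than one. -/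

import Mathlib

open MeasureTheory ProbabilityTheory Matrix
open scoped NNReal ENNReal

noncomputable section

namespace RegenerativeSwitching

/-! ### The `m`-lift of vectors and matrices -/

/-- The exponents `α ∈ ℕⁿ` with `α₁ + ⋯ + αₙ = m`; they index the coordinates of the `m`-lift. -/
abbrev Exponent (n m : ℕ) : Type :=
  {α : Fin n → ℕ // α ∈ Finset.piAntidiag (Finset.univ : Finset (Fin n)) m}

/-- The weight `√(α!)`, where `α! = m! / (α₁! ⋯ αₙ!)` is the multinomial coefficient. -/
def weight {n m : ℕ} (α : Exponent n m) : ℝ :=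
  Real.sqrt (Nat.multinomial Finset.univ α.1 : ℝ)

/-- The `m`-lift `x^[m]` of a vector: the family of the monomials `√(α!) x^α` with `|α| = m`. -/
def vecLift {n : ℕ} (m : ℕ) (x : Fin n → ℝ) : Exponent n m → ℝ :=
  fun α => weight α * ∏ i, x i ^ α.1 i

/-- The polynomial `(A X)^α = ∏ i, (∑ j, A i j X j) ^ α i`. -/
def linearMonomial {n : ℕ} (A : Matrix (Fin n) (Fin n) ℝ) (α : Fin n → ℕ) :
    MvPolynomial (Fin n) ℝ :=
  ∏ i, (∑ j, MvPolynomial.C (A i j) * MvPolynomial.X j) ^ α i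

/-- The `m`-lift `A^[m]` of a square matrix. Its defining property, that it is the unique matrix
with `(A x)^[m] = A^[m] x^[m]` for all `x`, is `eq_matLift_iff` below. -/
def matLift {n : ℕ} (m : ℕ) (A : Matrix (Fin n) (Fin n) ℝ) :
    Matrix (Exponent n m) (Exponent n m) ℝ :=
  fun α β => weight α / weight β *
    MvPolynomial.coeff (Finsupp.equivFunOnFinite.symm β.1) (linearMonomial A α.1)

theorem weight_pos {n m : ℕ} (α : Exponent n m) : 0 < weight α :=
  Real.sqrt_pos.2 (by exact_mod_cast Nat.multinomial_pos _ _)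

theorem linearMonomial_isHomogeneous {n m : ℕ} (A : Matrix (Fin n) (Fin n) ℝ)
    (α : Exponent n m) : (linearMonomial A α.1).IsHomogeneous m := by
  have h : (linearMonomial A α.1).IsHomogeneous (∑ i, 1 * α.1 i) := by
    refine MvPolynomial.IsHomogeneous.prod _ _ _ fun i _ => ?_
    refine MvPolynomial.IsHomogeneous.pow ?_ _
    refine MvPolynomial.IsHomogeneous.sum _ _ _ fun j _ => ?_
    exact MvPolynomial.isHomogeneous_C_mul_X _ _
  have hα := (Finset.mem_piAntidiag.1 α.2).1
  simpa [hα] using h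

/-- The defining identity `(A x)^[m] = A^[m] x^[m]`. -/
theorem matLift_mulVec_vecLift {n : ℕ} (m : ℕ) (A : Matrix (Fin n) (Fin n) ℝ) (x : Fin n → ℝ) :
    matLift m A *ᵥ vecLift m x = vecLift m (A *ᵥ x) := by
  funext α
  have h1 : ∏ i, (A *ᵥ x) i ^ α.1 i = MvPolynomial.eval x (linearMonomial A α.1) := by
    simp [linearMonomial, Matrix.mulVec, dotProduct, map_prod, map_sum]
  have h2 : MvPolynomial.eval x (linearMonomial A α.1) =
      ∑ β : Exponent n m, MvPolynomial.coeff (Finsupp.equivFunOnFinite.symm β.1)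
        (linearMonomial A α.1) * ∏ i, x i ^ β.1 i := by
    rw [MvPolynomial.eval_eq', Finset.sum_coe_sort (Finset.piAntidiag Finset.univ m)
      (fun β : Fin n → ℕ => MvPolynomial.coeff (Finsupp.equivFunOnFinite.symm β)
        (linearMonomial A α.1) * ∏ i, x i ^ β i)]
    refine Eq.trans ?_ (Finset.sum_map (Finset.piAntidiag Finset.univ m)
      (Finsupp.equivFunOnFinite (α := Fin n) (M := ℕ)).symm.toEmbedding
      (fun d => MvPolynomial.coeff d (linearMonomial A α.1) * ∏ i, x i ^ d i))
    refine Finset.sum_subset ?_ ?_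
    · intro d hd
      have hdeg := linearMonomial_isHomogeneous A α (MvPolynomial.mem_support_iff.1 hd)
      rw [Finset.mem_map]
      refine ⟨d, ?_, by simp⟩
      rw [Finset.mem_piAntidiag]
      refine ⟨?_, by simp⟩
      rw [← hdeg, Finsupp.weight_apply, Finsupp.sum_fintype _ _ (by simp)]
      simp
    · intro d _ hd
      rw [MvPolynomial.notMem_support_iff.1 hd, zero_mul]
  simp only [vecLift, Matrix.mulVec, dotProduct, matLift] at *
  rw [h1, h2, Finset.mul_sum]
  refine Finset.sum_congr rfl fun β _ => ?_
  have := (weight_pos β).ne'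
  field_simp

/-- `A^[m]` is the unique matrix `B` with `(A x)^[m] = B x^[m]` for every `x`. -/
theorem eq_matLift_iff {n : ℕ} (m : ℕ) (A : Matrix (Fin n) (Fin n) ℝ)
    (B : Matrix (Exponent n m) (Exponent n m) ℝ) :
    (∀ x : Fin n → ℝ, vecLift m (A *ᵥ x) = B *ᵥ vecLift m x) ↔ B = matLift m A := by
  constructor
  · intro h
    ext α β
    set p : MvPolynomial (Fin n) ℝ := ∑ γ : Exponent n m,
      MvPolynomial.monomial (Finsupp.equivFunOnFinite.symm γ.1)
        ((B α γ - matLift m A α γ) * weight γ) with hp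
    have hp0 : p = 0 := by
      refine MvPolynomial.funext fun x => ?_
      have h3 := congrFun ((h x).symm.trans (matLift_mulVec_vecLift m A x).symm) α
      simp only [Matrix.mulVec, dotProduct, vecLift] at h3
      rw [hp, map_sum, map_zero]
      simp only [MvPolynomial.eval_monomial]
      rw [← sub_eq_zero, ← Finset.sum_sub_distrib] at h3
      rw [← h3]
      refine Finset.sum_congr rfl fun γ _ => ?_
      rw [Finsupp.prod_fintype _ _ (by simp)]
      simp only [Finsupp.equivFunOnFinite_symm_apply_apply]
      ring
    have hc : MvPolynomial.coeff (Finsupp.equivFunOnFinite.symm β.1) p = 0 := by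
      rw [hp0, MvPolynomial.coeff_zero]
    rw [hp, MvPolynomial.coeff_sum, Finset.sum_eq_single β] at hc
    · rw [MvPolynomial.coeff_monomial, if_pos rfl] at hc
      have := (mul_eq_zero.1 hc).resolve_right (weight_pos β).ne'
      linarith
    · intro γ _ hγ
      rw [MvPolynomial.coeff_monomial, if_neg]
      intro hh
      exact hγ (Subtype.ext (Finsupp.equivFunOnFinite.symm.injective hh))
    · simp
  · rintro rfl x
    exact (matLift_mulVec_vecLift m A x).symm

/-- A real square matrix is Schur stable if its (complex) spectral radius is less than one. -/
def IsSchurStable {ι : Type*} [Fintype ι] [DecidableEq ι] (A : Matrix ι ι ℝ) : Prop :=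
  spectralRadius ℂ (A.map (fun r : ℝ => (r : ℂ))) < 1

/-! ### Linear differential equations with measurable coefficients -/

/-- `x` is a (Carathéodory) solution on `[0, ∞)` of `dx/dt = a(t) x`, `x(0) = x₀`. -/
structure IsTrajectory {n : ℕ} (a : ℝ → Matrix (Fin n) (Fin n) ℝ) (x₀ : Fin n → ℝ)
    (x : ℝ → Fin n → ℝ) : Prop where
  continuousOn : ContinuousOn x (Set.Ici 0)
  intervalIntegrable : ∀ t, 0 ≤ t → ∀ i,
    IntervalIntegrable (fun s => (a s *ᵥ x s) i) volume 0 t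
  integral_eq : ∀ t, 0 ≤ t → ∀ i, x t i = x₀ i + ∫ s in (0 : ℝ)..t, (a s *ᵥ x s) i

/-- The solution on `[0, ∞)` of `dx/dt = a(t) x`, `x(0) = x₀`. -/
def trajectory {n : ℕ} (a : ℝ → Matrix (Fin n) (Fin n) ℝ) (x₀ : Fin n → ℝ) : ℝ → Fin n → ℝ :=
  Classical.epsilon (IsTrajectory a x₀)

/-- `Φ` is a (Carathéodory) solution on `[t₀, ∞)` of `∂Φ/∂t = a(t) Φ`, `Φ(t₀) = I`. -/
structure IsFundamental {n : ℕ} (a : ℝ → Matrix (Fin n) (Fin n) ℝ) (t₀ : ℝ)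
    (Φ : ℝ → Matrix (Fin n) (Fin n) ℝ) : Prop where
  continuousOn : ContinuousOn Φ (Set.Ici t₀)
  intervalIntegrable : ∀ t, t₀ ≤ t → ∀ i j,
    IntervalIntegrable (fun s => (a s * Φ s) i j) volume t₀ t
  integral_eq : ∀ t, t₀ ≤ t → ∀ i j,
    Φ t i j = (1 : Matrix (Fin n) (Fin n) ℝ) i j + ∫ s in t₀..t, (a s * Φ s) i j

/-- The fundamental matrix `t ↦ Φ(t₀, t)` of `dx/dt = a(t) x`. -/
def fundamentalMatrix {n : ℕ} (a : ℝ → Matrix (Fin n) (Fin n) ℝ) (t₀ : ℝ) :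
    ℝ → Matrix (Fin n) (Fin n) ℝ :=
  Classical.epsilon (IsFundamental a t₀)

/-! ### Regenerative processes -/

section Regenerative

variable {Ω S : Type*} [MeasurableSpace Ω] [MeasurableSpace S]

/-- The σ-algebra generated by the first cycle `({σ_t}_{t < R}, R)`. -/
@[reducible] def cycleSigmaAlgebra (σ : ℝ≥0 → Ω → S) (R : Ω → ℝ≥0) : MeasurableSpace Ω :=
  MeasurableSpace.comap R inferInstance ⊔
    MeasurableSpace.generateFrom
      {E | ∃ (t : ℝ≥0) (B : Set S), MeasurableSet B ∧ E = {ω | t < R ω ∧ σ t ω ∈ B}}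

/-- The sample path `t ↦ σ_{t + R}` after the time `R`. -/
def shiftedPath (σ : ℝ≥0 → Ω → S) (R : Ω → ℝ≥0) (ω : Ω) : ℝ≥0 → S :=
  fun t => σ (t + R ω) ω

/-- `R` is a regeneration epoch of the process `σ`: an (almost surely) positive random variable
such that `{σ_{t + R}}` is independent of `({σ_t}_{t < R}, R)` and has the same law as `{σ_t}`
(equality of laws for the product σ-algebra, i.e. of the finite-dimensional distributions). -/
structure IsRegenerationEpoch (P : Measure Ω) (σ : ℝ≥0 → Ω → S) (R : Ω → ℝ≥0) : Prop where
  measurable : Measurable R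
  pos : ∀ᵐ ω ∂P, 0 < R ω
  indep : Indep (MeasurableSpace.comap (shiftedPath σ R) MeasurableSpace.pi)
    (cycleSigmaAlgebra σ R) P
  identDistrib : IdentDistrib (shiftedPath σ R) (fun ω t => σ t ω) P P

end Regenerative

/-! ### Switched linear systems and their stability -/

section System

variable {Ω S : Type*} {n : ℕ}

/-- The coefficient `t ↦ A_{σ_t(ω)}`; only the values at `t ≥ 0` matter. -/
def coefficient (A : S → Matrix (Fin n) (Fin n) ℝ) (σ : ℝ≥0 → Ω → S) (ω : Ω) :
    ℝ → Matrix (Fin n) (Fin n) ℝ :=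
  fun t => A (σ t.toNNReal ω)

/-- The state `x(t)` at time `t` of the system `dx/dt = A_{σ_t} x`, `x(0) = x₀`. -/
def state (A : S → Matrix (Fin n) (Fin n) ℝ) (σ : ℝ≥0 → Ω → S) (x₀ : Fin n → ℝ)
    (t : ℝ) (ω : Ω) : Fin n → ℝ :=
  trajectory (coefficient A σ ω) x₀ t

/-- The fundamental matrix `M₀(ω) = Φ(ω; 0, R(ω))` over the first cycle. -/
def firstCycleMatrix (A : S → Matrix (Fin n) (Fin n) ℝ) (σ : ℝ≥0 → Ω → S) (R : Ω → ℝ≥0)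
    (ω : Ω) : Matrix (Fin n) (Fin n) ℝ :=
  fundamentalMatrix (coefficient A σ ω) 0 (R ω)

variable [MeasurableSpace Ω]

/-- The moment `E[‖x(t)‖^m]` (Euclidean norm), with values in `[0, ∞]`. -/
def moment (P : Measure Ω) (A : S → Matrix (Fin n) (Fin n) ℝ) (σ : ℝ≥0 → Ω → S) (m : ℕ)
    (x₀ : Fin n → ℝ) (t : ℝ) : ℝ≥0∞ :=
  ∫⁻ ω, ENNReal.ofReal (‖WithLp.toLp 2 (state A σ x₀ t ω)‖ ^ m) ∂P

/-- Exponential `m`th mean stability. -/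
def IsExpMeanStable (P : Measure Ω) (A : S → Matrix (Fin n) (Fin n) ℝ) (σ : ℝ≥0 → Ω → S)
    (m : ℕ) : Prop :=
  ∃ α > (0 : ℝ), ∃ β > (0 : ℝ), ∀ (x₀ : Fin n → ℝ) (t : ℝ), 0 ≤ t →
    moment P A σ m x₀ t ≤ ENNReal.ofReal (α * Real.exp (-β * t) * ‖WithLp.toLp 2 x₀‖ ^ m)

/-- Stochastic `m`th mean stability. -/
def IsStochMeanStable (P : Measure Ω) (A : S → Matrix (Fin n) (Fin n) ℝ) (σ : ℝ≥0 → Ω → S)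
    (m : ℕ) : Prop :=
  ∀ x₀ : Fin n → ℝ, ∫⁻ t in Set.Ioi (0 : ℝ), moment P A σ m x₀ t < ∞

/-- Positivity: `x₀ ≥ 0` implies `x(t) ≥ 0` almost surely, for every `t ≥ 0`. -/
def IsPositiveSystem (P : Measure Ω) (A : S → Matrix (Fin n) (Fin n) ℝ) (σ : ℝ≥0 → Ω → S) :
    Prop :=
  ∀ x₀ : Fin n → ℝ, (∀ i, 0 ≤ x₀ i) → ∀ t : ℝ, 0 ≤ t →
    ∀ᵐ ω ∂P, ∀ i, 0 ≤ state A σ x₀ t ω i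

/-- The matrix `E[M₀^[m]]` of the entrywise expectations. -/
def expectedLift (P : Measure Ω) (A : S → Matrix (Fin n) (Fin n) ℝ) (σ : ℝ≥0 → Ω → S)
    (R : Ω → ℝ≥0) (m : ℕ) : Matrix (Exponent n m) (Exponent n m) ℝ :=
  fun α β => ∫ ω, matLift m (firstCycleMatrix A σ R ω) α β ∂P

end System

end RegenerativeSwitching

end

/-!
The matrix `B = E[M₀^[m]]` is compared with the moments of the system through the form
`q(x) = ∑ xᵢ^m`. It is linear in the lift `x^[m]`, and on the cone `InCone m` (all of `ℝⁿ` if `m` is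
even, the nonnegative orthant otherwise) it is comparable to `‖x‖^m`. By hypothesis the cone is
almost surely invariant, so a linear form `v` on the lifted space that is nonnegative on lifts of
vectors of the cone is carried by `B` to such a form: `(v B)(x) = E[v(M₀ x)]`. Writing
`W_ρ = ∫₀^∞ ρ(t) E[Φ(t)^[m]] dt`, everything follows from the renewal equation
`(q W_ρ)(x) = E ∫₀^R ρ(t) q(Φ(t) x) dt + ∫₀^∞ E[ρ(t + R) q(Φ(t + R) x)] dt`
(`weightedLift_renewal`) together with `E[Φ(t + R)^[m]] = E[Φ(t)^[m]] B`
(`integral_matLift_flow_add_epoch`).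

* Stochastic stability implies Schur stability. For `ρ = 1` the form `w = q W_ρ` is finite, and the
  renewal equation reads `w ≥ δ q + w B` on the cone, because `R > 0` and the state changes little
  over short times. Telescoping makes `∑ (q B^k)(x)` converge, so `q B^k → 0` on the cone; since `q`
  dominates every form there and the lifts of nonnegative vectors span, `B^k → 0`
  (`isSchurStable_of_coneLE`).
* Schur stability implies exponential stability. For `ρ(t) = e^{βt}` cut off at time `τ`, the
  renewal equation gives `w ≤ c q + e^{βT} w B` with `T` a bound of `R`. If `β` is small, the powers
  of `e^{βT} B` are summable, and iterating bounds `w` uniformly in `τ` (`exists_bound_of_coneLE`).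
  As the norm of the state can only halve over a short time, the bound of the weighted integrals
  gives a pointwise one, first on the cone, then for differences of nonnegative initial states.

The relation `E[Φ(t + R)^[m]] = E[Φ(t)^[m]] B` needs the flow of the shifted process to be
independent of the first cycle and to have the law of the original flow. Only the finite-dimensional
distributions are given, so the flow has to be a functional of the sample path, measurable for the
product σ-algebra up to null sets. It is the sum of the Peano–Baker series of iterated time
integrals, and a time integral of random variables that are measurable for a σ-algebra `𝒢` up to
null sets is again so, being orthogonal to the error of conditioning it on `𝒢`
(`aestronglyMeasurable_setIntegral_Ioc`). The series also supplies the solutions of the differential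
equation, whose coefficient is only measurable in time.
-/

namespace RegenerativeSwitching

/-! ### Algebra of the `m`-lift -/

theorem matLift_mul {n : ℕ} (m : ℕ) (A B : Matrix (Fin n) (Fin n) ℝ) :
    matLift m (A * B) = matLift m A * matLift m B := by
  refine ((eq_matLift_iff m (A * B) _).1 fun x => ?_).symm
  rw [← Matrix.mulVec_mulVec, ← Matrix.mulVec_mulVec, matLift_mulVec_vecLift,
    matLift_mulVec_vecLift]

theorem continuous_vecLift {n : ℕ} (m : ℕ) : Continuous (vecLift (n := n) m) := by
  unfold vecLift
  fun_prop

theorem abs_vecLift_le {n m : ℕ} (x : Fin n → ℝ) (α : Exponent n m) :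
    |vecLift m x α| ≤ weight α * ‖x‖ ^ m := by
  have hα := (Finset.mem_piAntidiag.1 α.2).1
  rw [vecLift, abs_mul, abs_of_pos (weight_pos α), Finset.abs_prod]
  refine mul_le_mul_of_nonneg_left ?_ (weight_pos α).le
  calc ∏ i, |x i ^ α.1 i| ≤ ∏ i, ‖x‖ ^ α.1 i := by
        refine Finset.prod_le_prod (fun i _ => abs_nonneg _) fun i _ => ?_
        rw [abs_pow]
        exact pow_le_pow_left₀ (abs_nonneg _) (norm_le_pi_norm x i) _
    _ = ‖x‖ ^ m := by rw [Finset.prod_pow_eq_pow_sum, hα]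

theorem abs_dotProduct_vecLift_le {n m : ℕ} (v : Exponent n m → ℝ) (x : Fin n → ℝ) :
    |v ⬝ᵥ vecLift m x| ≤ (∑ α, |v α| * weight α) * ‖x‖ ^ m := by
  rw [dotProduct, Finset.sum_mul]
  refine (Finset.abs_sum_le_sum_abs _ _).trans (Finset.sum_le_sum fun α _ => ?_)
  rw [abs_mul, mul_assoc]
  exact mul_le_mul_of_nonneg_left (abs_vecLift_le x α) (abs_nonneg _)

/-- A homogeneous polynomial that vanishes on the nonnegative orthant is zero. -/
theorem eq_zero_of_dotProduct_vecLift {n m : ℕ} (v : Exponent n m → ℝ)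
    (h : ∀ x : Fin n → ℝ, (∀ i, 0 ≤ x i) → v ⬝ᵥ vecLift m x = 0) : v = 0 := by
  set p : MvPolynomial (Fin n) ℝ := ∑ γ : Exponent n m,
    MvPolynomial.monomial (Finsupp.equivFunOnFinite.symm γ.1) (v γ * weight γ) with hp
  have hp0 : p = 0 := by
    refine MvPolynomial.funext_set (fun _ => Set.Ici (0 : ℝ))
      (fun _ => Set.Ici_infinite 0) fun x hx => ?_
    have h3 := h x fun i => hx i (Set.mem_univ i)
    rw [hp, map_sum, map_zero, ← h3, dotProduct]
    refine Finset.sum_congr rfl fun γ _ => ?_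
    rw [MvPolynomial.eval_monomial, Finsupp.prod_fintype _ _ (by simp), vecLift]
    simp only [Finsupp.equivFunOnFinite_symm_apply_apply]
    ring
  funext β
  have hc : MvPolynomial.coeff (Finsupp.equivFunOnFinite.symm β.1) p = 0 := by
    rw [hp0, MvPolynomial.coeff_zero]
  rw [hp, MvPolynomial.coeff_sum, Finset.sum_eq_single β] at hc
  · rw [MvPolynomial.coeff_monomial, if_pos rfl] at hc
    exact (mul_eq_zero.1 hc).resolve_right (weight_pos β).ne'
  · intro γ _ hγ
    rw [MvPolynomial.coeff_monomial, if_neg]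
    intro hh
    exact hγ (Subtype.ext (Finsupp.equivFunOnFinite.symm.injective hh))
  · simp

theorem span_vecLift (n m : ℕ) :
    Submodule.span ℝ (vecLift m '' {x : Fin n → ℝ | ∀ i, 0 ≤ x i}) = ⊤ := by
  by_contra hne
  obtain ⟨f, hf0, hf⟩ := Submodule.exists_le_ker_of_lt_top _ (lt_top_iff_ne_top.2 hne)
  refine hf0 ?_
  have hfv : ∀ w, f w = (fun α => f (Pi.single α 1)) ⬝ᵥ w := fun w => by
    rw [LinearMap.pi_apply_eq_sum_univ f w, dotProduct]
    refine Finset.sum_congr rfl fun α _ => ?_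
    rw [smul_eq_mul, mul_comm]
    congr 2
    funext β
    simp [Pi.single_apply, eq_comm]
  have h0 := eq_zero_of_dotProduct_vecLift (fun α => f (Pi.single α 1)) fun x hx => by
    rw [← hfv]
    exact hf (Submodule.subset_span ⟨x, hx, rfl⟩)
  refine LinearMap.ext fun w => ?_
  rw [hfv, h0, zero_dotProduct, LinearMap.zero_apply]

/-- Every coordinate vector of the lifted space is a combination of lifts of nonnegative vectors,
so the entries of `M^[m]` are combinations of coordinates of lifts `(M x)^[m]`. -/
theorem exists_matLift_eq_sum {n m : ℕ} (β : Exponent n m) :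
    ∃ (N : ℕ) (c : Fin N → ℝ) (x : Fin N → Fin n → ℝ),
      ∀ (M : Matrix (Fin n) (Fin n) ℝ) (α : Exponent n m),
        matLift m M α β = ∑ j, c j * vecLift m (M *ᵥ x j) α := by
  have hmem : (Pi.single β 1 : Exponent n m → ℝ) ∈
      Submodule.span ℝ (vecLift m '' {x : Fin n → ℝ | ∀ i, 0 ≤ x i}) := by
    rw [span_vecLift]; trivial
  obtain ⟨N, c, g, hg⟩ := (Submodule.mem_span_set').1 hmem
  choose x hx using fun j => (g j).2
  refine ⟨N, c, x, fun M α => ?_⟩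
  have h1 : (matLift m M *ᵥ Pi.single β 1) α = matLift m M α β := by simp
  rw [← h1, ← hg, Matrix.mulVec_sum, Finset.sum_apply]
  refine Finset.sum_congr rfl fun j _ => ?_
  rw [Matrix.mulVec_smul, ← (hx j).2, matLift_mulVec_vecLift]
  rfl

theorem continuous_matLift {n m : ℕ} (α β : Exponent n m) :
    Continuous fun M : Matrix (Fin n) (Fin n) ℝ => matLift m M α β := by
  obtain ⟨N, c, x, h⟩ := exists_matLift_eq_sum β
  simp only [h]
  have := continuous_vecLift (n := n) m
  fun_prop

/-- The entries of a lift are dominated by the `m`th powers of finitely many vectors `M x`. -/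
theorem exists_abs_matLift_le {n m : ℕ} (α β : Exponent n m) :
    ∃ (N : ℕ) (c : Fin N → ℝ) (x : Fin N → Fin n → ℝ), (∀ j, 0 ≤ c j) ∧
      ∀ M : Matrix (Fin n) (Fin n) ℝ, |matLift m M α β| ≤ ∑ j, c j * ‖M *ᵥ x j‖ ^ m := by
  obtain ⟨N, c, x, h⟩ := exists_matLift_eq_sum β
  refine ⟨N, fun j => |c j| * weight α, x, fun j => by have := weight_pos α; positivity,
    fun M => ?_⟩
  rw [h]
  refine (Finset.abs_sum_le_sum_abs _ _).trans (Finset.sum_le_sum fun j _ => ?_)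
  rw [abs_mul, mul_assoc]
  exact mul_le_mul_of_nonneg_left (abs_vecLift_le _ α) (abs_nonneg _)

theorem norm_mulVec_le {n : ℕ} {M : Matrix (Fin n) (Fin n) ℝ} {C : ℝ} (hC : 0 ≤ C)
    (h : ∀ i j, |M i j| ≤ C) (x : Fin n → ℝ) : ‖M *ᵥ x‖ ≤ n * C * ‖x‖ := by
  refine (pi_norm_le_iff_of_nonneg (by positivity)).2 fun i => ?_
  calc ‖(M *ᵥ x) i‖ ≤ ∑ j, ‖M i j * x j‖ := norm_sum_le Finset.univ fun j => M i j * x j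
    _ ≤ ∑ _j : Fin n, C * ‖x‖ := Finset.sum_le_sum fun j _ => by
        rw [norm_mul]
        exact mul_le_mul (h i j) (norm_le_pi_norm x j) (norm_nonneg _) hC
    _ = n * C * ‖x‖ := by simp [mul_assoc]

theorem exists_abs_matLift_le_of_abs_le {n m : ℕ} {C : ℝ} (hC : 0 ≤ C) (α β : Exponent n m) :
    ∃ D : ℝ, ∀ M : Matrix (Fin n) (Fin n) ℝ, (∀ i j, |M i j| ≤ C) → |matLift m M α β| ≤ D := by
  obtain ⟨N, c, x, hc, h⟩ := exists_abs_matLift_le α β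
  refine ⟨∑ j, c j * (n * C * ‖x j‖) ^ m, fun M hM => (h M).trans ?_⟩
  refine Finset.sum_le_sum fun j _ => mul_le_mul_of_nonneg_left ?_ (hc j)
  exact pow_le_pow_left₀ (norm_nonneg _) (norm_mulVec_le hC hM _) _

/-! ### The form `∑ i, x i ^ m` -/

/-- The covector on the lifted space that represents the form `x ↦ ∑ i, x i ^ m`. -/
noncomputable def powerSumCovector (n m : ℕ) : Exponent n m → ℝ :=
  ∑ i, Pi.single ⟨Pi.single i m, by simp [Finset.mem_piAntidiag]⟩
    (weight (n := n) (m := m) ⟨Pi.single i m, by simp [Finset.mem_piAntidiag]⟩)⁻¹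

theorem powerSumCovector_dotProduct {n m : ℕ} (x : Fin n → ℝ) :
    powerSumCovector n m ⬝ᵥ vecLift m x = ∑ i, x i ^ m := by
  rw [powerSumCovector, sum_dotProduct]
  refine Finset.sum_congr rfl fun i _ => ?_
  rw [single_dotProduct, vecLift, ← mul_assoc, inv_mul_cancel₀ (weight_pos _).ne', one_mul,
    Finset.prod_eq_single i]
  · simp
  · intro j _ hj
    simp [hj]
  · simp

/-- The vectors on which `∑ i, x i ^ m` is a sum of nonnegative terms by hypothesis: all vectors
if `m` is even, the nonnegative orthant otherwise. -/
def InCone {n : ℕ} (m : ℕ) (x : Fin n → ℝ) : Prop := Even m ∨ ∀ i, 0 ≤ x i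

theorem InCone.pow_eq {n m : ℕ} {x : Fin n → ℝ} (hx : InCone m x) (i : Fin n) :
    x i ^ m = |x i| ^ m := by
  rcases hx with h | h
  · exact (h.pow_abs _).symm
  · rw [abs_of_nonneg (h i)]

theorem InCone.norm_pow_le {n m : ℕ} (hm : 0 < m) {x : Fin n → ℝ} (hx : InCone m x) :
    ‖x‖ ^ m ≤ powerSumCovector n m ⬝ᵥ vecLift m x := by
  rw [powerSumCovector_dotProduct]
  simp only [hx.pow_eq]
  rcases isEmpty_or_nonempty (Fin n) with h | h
  · simp [Pi.norm_def, hm.ne']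
  · obtain ⟨i, hi⟩ := Finite.exists_max fun i => ‖x i‖
    have h1 : ‖x‖ ≤ |x i| := (pi_norm_le_iff_of_nonneg (abs_nonneg _)).2 hi
    exact (pow_le_pow_left₀ (norm_nonneg _) h1 m).trans
      (Finset.single_le_sum (f := fun i => |x i| ^ m) (fun j _ => by positivity)
        (Finset.mem_univ i))

theorem InCone.le_norm_pow {n m : ℕ} {x : Fin n → ℝ} (hx : InCone m x) :
    powerSumCovector n m ⬝ᵥ vecLift m x ≤ n * ‖x‖ ^ m := by
  rw [powerSumCovector_dotProduct]
  simp only [hx.pow_eq]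
  calc ∑ i, |x i| ^ m ≤ ∑ _i : Fin n, ‖x‖ ^ m := Finset.sum_le_sum fun i _ =>
        pow_le_pow_left₀ (abs_nonneg _) (norm_le_pi_norm x i) _
    _ = n * ‖x‖ ^ m := by simp

theorem isClosed_inCone (n m : ℕ) : IsClosed {x : Fin n → ℝ | InCone m x} := by
  by_cases h : Even m
  · simp [InCone, h]
  · simp only [InCone, h, false_or, Set.ofPred_forall]
    exact isClosed_iInter fun i => isClosed_le continuous_const (continuous_apply i)

theorem norm_le_norm_toLp {n : ℕ} (x : Fin n → ℝ) : ‖x‖ ≤ ‖WithLp.toLp 2 x‖ :=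
  (pi_norm_le_iff_of_nonneg (norm_nonneg _)).2 fun i => PiLp.norm_apply_le (WithLp.toLp 2 x) i

theorem norm_toLp_le {n : ℕ} (x : Fin n → ℝ) : ‖WithLp.toLp 2 x‖ ≤ n * ‖x‖ := by
  rw [EuclideanSpace.norm_eq]
  refine Real.sqrt_le_iff.2 ⟨by positivity, ?_⟩
  calc ∑ i, ‖x i‖ ^ 2 ≤ ∑ _i : Fin n, ‖x‖ ^ 2 := Finset.sum_le_sum fun i _ =>
        pow_le_pow_left₀ (norm_nonneg _) (norm_le_pi_norm x i) _
    _ = n * ‖x‖ ^ 2 := by simp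
    _ ≤ (n : ℝ) ^ 2 * ‖x‖ ^ 2 := by
        refine mul_le_mul_of_nonneg_right ?_ (by positivity)
        exact_mod_cast Nat.le_self_pow two_ne_zero n
    _ = (n * ‖x‖) ^ 2 := by ring

/-! ### The Peano–Baker series -/

/-- The `k`th term of the Peano–Baker series of `dΦ/dt = a(t) Φ`, an iterated integral.
The integrals are over `(0, t]`, so that for `t < 0` they vanish. -/
noncomputable def peanoBaker {n : ℕ} (a : ℝ → Matrix (Fin n) (Fin n) ℝ) :
    ℕ → ℝ → Matrix (Fin n) (Fin n) ℝ
  | 0, _ => 1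
  | k + 1, t => Matrix.of fun i j => ∫ s in Set.Ioc 0 t, (a s * peanoBaker a k s) i j

/-- The sum of the Peano–Baker series: the explicit fundamental matrix of `dx/dt = a(t) x`. -/
noncomputable def flow {n : ℕ} (a : ℝ → Matrix (Fin n) (Fin n) ℝ) (t : ℝ) :
    Matrix (Fin n) (Fin n) ℝ :=
  Matrix.of fun i j => ∑' k, peanoBaker a k t i j

theorem measurable_setIntegral_Ioc {X : Type*} [MeasurableSpace X] {f : ℝ × X → ℝ}
    (hf : Measurable f) : Measurable fun p : ℝ × X => ∫ s in Set.Ioc 0 p.1, f (s, p.2) := by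
  have h1 : Measurable fun q : (ℝ × X) × ℝ =>
      Set.indicator {q : (ℝ × X) × ℝ | 0 < q.2 ∧ q.2 ≤ q.1.1} (fun q => f (q.2, q.1.2)) q := by
    refine Measurable.indicator (by fun_prop) ?_
    exact (measurableSet_lt measurable_const measurable_snd).inter
      (measurableSet_le measurable_snd (by fun_prop))
  have h2 := (h1.stronglyMeasurable.integral_prod_right' (ν := volume)).measurable
  convert h2 using 2 with p
  rw [← integral_indicator measurableSet_Ioc]
  rfl

theorem measurable_peanoBaker {n : ℕ} {X : Type*} [MeasurableSpace X]
    {a : X → ℝ → Matrix (Fin n) (Fin n) ℝ}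
    (ha : ∀ i j, Measurable fun p : ℝ × X => a p.2 p.1 i j) (k : ℕ) (i j : Fin n) :
    Measurable fun p : ℝ × X => peanoBaker (a p.2) k p.1 i j := by
  induction k generalizing i j with
  | zero => exact measurable_const
  | succ k ih =>
    refine measurable_setIntegral_Ioc
      (f := fun p : ℝ × X => (a p.2 p.1 * peanoBaker (a p.2) k p.1) i j) ?_
    simp only [Matrix.mul_apply]
    exact Finset.measurable_sum _ fun l _ => (ha i l).mul (ih l j)

section Path

variable {n : ℕ} {a : ℝ → Matrix (Fin n) (Fin n) ℝ} {C : ℝ}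

theorem abs_mul_apply_le {A M : Matrix (Fin n) (Fin n) ℝ} {D : ℝ} (hC : ∀ i j, |A i j| ≤ C)
    (hD : ∀ i j, |M i j| ≤ D) (i j : Fin n) : |(A * M) i j| ≤ n * C * D := by
  have hC0 : 0 ≤ C := (abs_nonneg _).trans (hC i j)
  calc |(A * M) i j| ≤ ∑ l, |A i l * M l j| :=
        Finset.abs_sum_le_sum_abs (fun l => A i l * M l j) Finset.univ
    _ ≤ ∑ _l : Fin n, C * D := Finset.sum_le_sum fun l _ => by
        rw [abs_mul]
        exact mul_le_mul (hC i l) (hD l j) (abs_nonneg _) hC0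
    _ = n * C * D := by simp [mul_assoc]

theorem integral_Ioc_pow_div_factorial (K : ℝ) (k : ℕ) {t : ℝ} (ht : 0 ≤ t) :
    ∫ s in Set.Ioc 0 t, K * ((K * s) ^ k / k.factorial) =
      (K * t) ^ (k + 1) / (k + 1).factorial := by
  have h : ∀ s : ℝ, K * ((K * s) ^ k / k.factorial) = K ^ (k + 1) / k.factorial * s ^ k := by
    intro s; rw [mul_pow]; ring
  simp only [h]
  rw [← intervalIntegral.integral_of_le ht, intervalIntegral.integral_const_mul, integral_pow,
    Nat.factorial_succ]
  push_cast
  have : (k.factorial : ℝ) ≠ 0 := by positivity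
  field_simp
  ring

theorem measurable_peanoBaker_path (ha : ∀ i j, Measurable fun s => a s i j) (k : ℕ)
    (i j : Fin n) : Measurable fun s => peanoBaker a k s i j :=
  (measurable_peanoBaker (X := Unit) (a := fun _ => a)
    (fun i j => (ha i j).comp measurable_fst) k i j).comp
      (measurable_id.prodMk (measurable_const (a := ())))

/-- The bound for iterated integrals that gives convergence of the Peano–Baker series and
uniqueness of solutions. -/
theorem abs_setIntegral_Ioc_le {K M : ℝ} {k : ℕ} {f : ℝ → ℝ} {t : ℝ}
    (ht : 0 ≤ t) (h : ∀ s, 0 ≤ s → s ≤ t → |f s| ≤ K * (M * ((K * s) ^ k / k.factorial))) :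
    |∫ s in Set.Ioc 0 t, f s| ≤ M * ((K * t) ^ (k + 1) / (k + 1).factorial) := by
  rw [← integral_Ioc_pow_div_factorial K k ht, ← integral_const_mul]
  have hg : IntegrableOn (fun s => M * (K * ((K * s) ^ k / k.factorial))) (Set.Ioc 0 t) :=
    Continuous.integrableOn_Ioc (by fun_prop)
  rw [← Real.norm_eq_abs]
  refine norm_integral_le_of_norm_le hg ?_
  filter_upwards [ae_restrict_mem measurableSet_Ioc] with s hs
  refine (h s hs.1.le hs.2).trans (le_of_eq ?_)
  ring

theorem abs_peanoBaker_le (hC : ∀ s i j, |a s i j| ≤ C) (k : ℕ) {t : ℝ} (ht : 0 ≤ t)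
    (i j : Fin n) : |peanoBaker a k t i j| ≤ (n * C * t) ^ k / k.factorial := by
  induction k generalizing t i j with
  | zero =>
    simp only [peanoBaker, Matrix.one_apply]
    split_ifs <;> simp
  | succ k ih =>
    have := abs_setIntegral_Ioc_le (K := n * C) (M := 1) (k := k)
      (f := fun s => (a s * peanoBaker a k s) i j) ht fun s hs _ => by
        rw [one_mul]
        exact abs_mul_apply_le (hC s) (fun i j => ih hs i j) i j
    simpa [peanoBaker] using this

theorem summable_peanoBaker (hC : ∀ s i j, |a s i j| ≤ C) {t : ℝ} (ht : 0 ≤ t) (i j : Fin n) :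
    Summable fun k => peanoBaker a k t i j :=
  Summable.of_norm_bounded (Real.summable_pow_div_factorial (n * C * t))
    fun k => abs_peanoBaker_le hC k ht i j

theorem abs_flow_sub_one_le (hC : ∀ s i j, |a s i j| ≤ C) {t : ℝ} (ht : 0 ≤ t) (i j : Fin n) :
    |flow a t i j - (1 : Matrix (Fin n) (Fin n) ℝ) i j| ≤ Real.exp (n * C * t) - 1 := by
  have hs := summable_peanoBaker hC ht i j
  have he : Real.exp (n * C * t) = ∑' k : ℕ, (n * C * t) ^ k / k.factorial := by
    rw [Real.exp_eq_exp_ℝ, NormedSpace.exp_eq_tsum_div]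
  have hsb := Real.summable_pow_div_factorial (n * C * t)
  rw [flow, Matrix.of_apply, hs.tsum_eq_zero_add, he, hsb.tsum_eq_zero_add]
  simp only [peanoBaker, pow_zero, Nat.factorial_zero, Nat.cast_one, div_one,
    add_sub_cancel_left]
  have hsb' := (summable_nat_add_iff 1).2 hsb
  exact tsum_of_norm_bounded hsb'.hasSum (f := fun k => peanoBaker a (k + 1) t i j)
    fun k => abs_peanoBaker_le hC (k + 1) ht i j

theorem abs_flow_le (hC : ∀ s i j, |a s i j| ≤ C) {t : ℝ} (ht : 0 ≤ t) (i j : Fin n) :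
    |flow a t i j| ≤ Real.exp (n * C * t) := by
  have h1 := abs_flow_sub_one_le hC ht i j
  have h2 : |(1 : Matrix (Fin n) (Fin n) ℝ) i j| ≤ 1 := by
    rw [Matrix.one_apply]; split_ifs <;> simp
  have h3 := abs_add_le (flow a t i j - (1 : Matrix (Fin n) (Fin n) ℝ) i j)
    ((1 : Matrix (Fin n) (Fin n) ℝ) i j)
  rw [sub_add_cancel] at h3
  linarith

theorem abs_flow_le_of_le (hC : ∀ s i j, |a s i j| ≤ C) {t T : ℝ} (ht : 0 ≤ t) (htT : t ≤ T)
    (i j : Fin n) : |flow a t i j| ≤ Real.exp (n * C * T) := by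
  have hC0 : 0 ≤ C := (abs_nonneg _).trans (hC 0 i j)
  refine (abs_flow_le hC ht i j).trans (Real.exp_le_exp.2 ?_)
  gcongr

theorem measurable_flow {X : Type*} [MeasurableSpace X]
    {a : X → ℝ → Matrix (Fin n) (Fin n) ℝ}
    (ha : ∀ i j, Measurable fun p : ℝ × X => a p.2 p.1 i j)
    (hC : ∀ x s i j, |a x s i j| ≤ C) (i j : Fin n) :
    Measurable fun p : ℝ × X => flow (a p.2) p.1 i j := by
  -- The partial sums converge for nonnegative times only; for negative times the sum is constant.
  have hneg : ∀ (x : X) (t : ℝ) (k : ℕ), t < 0 → peanoBaker (a x) (k + 1) t i j = 0 := by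
    intro x t k ht
    simp [peanoBaker, Set.Ioc_eq_empty (not_lt.2 ht.le)]
  refine measurable_of_tendsto_metrizable
    (f := fun (N : ℕ) (p : ℝ × X) => ∑ k ∈ Finset.range N, peanoBaker (a p.2) k p.1 i j)
    (fun N => Finset.measurable_sum _ fun k _ => measurable_peanoBaker ha k i j)
    (tendsto_pi_nhds.2 fun p => ?_)
  rcases le_or_gt 0 p.1 with h | h
  · exact (summable_peanoBaker (hC p.2) h i j).hasSum.tendsto_sum_nat
  · refine Summable.tendsto_sum_tsum_nat ?_
    refine (summable_nat_add_iff 1).1 ?_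
    simp only [hneg _ _ _ h]
    exact summable_zero

theorem measurable_flow_path (ha : ∀ i j, Measurable fun s => a s i j)
    (hC : ∀ s i j, |a s i j| ≤ C) (i j : Fin n) : Measurable fun s => flow a s i j :=
  (measurable_flow (X := Unit) (a := fun _ => a)
    (fun i j => (ha i j).comp measurable_fst) (fun _ => hC) i j).comp
      (measurable_id.prodMk (measurable_const (a := ())))

theorem integrableOn_mul_flow (ha : ∀ i j, Measurable fun s => a s i j)
    (hC : ∀ s i j, |a s i j| ≤ C) (t : ℝ) (i j : Fin n) :
    IntegrableOn (fun s => (a s * flow a s) i j) (Set.Ioc 0 t) := by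
  refine Measure.integrableOn_of_bounded (M := n * C * Real.exp (n * C * t)) (by simp) ?_ ?_
  · simp only [Matrix.mul_apply]
    exact (Finset.measurable_sum _ fun l _ =>
      (ha i l).mul (measurable_flow_path ha hC l j)).aestronglyMeasurable
  · filter_upwards [ae_restrict_mem measurableSet_Ioc] with s hs
    exact abs_mul_apply_le (hC s) (abs_flow_le_of_le hC hs.1.le hs.2) i j

theorem flow_eq (ha : ∀ i j, Measurable fun s => a s i j)
    (hC : ∀ s i j, |a s i j| ≤ C) {t : ℝ} (ht : 0 ≤ t) (i j : Fin n) :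
    flow a t i j = (1 : Matrix (Fin n) (Fin n) ℝ) i j +
      ∫ s in Set.Ioc 0 t, (a s * flow a s) i j := by
  have hs := summable_peanoBaker hC ht i j
  rw [flow, Matrix.of_apply, hs.tsum_eq_zero_add]
  congr 1
  refine HasSum.tsum_eq ?_
  refine hasSum_integral_of_dominated_convergence
    (fun k _ => n * C * ((n * C * t) ^ k / k.factorial)) (fun k => ?_) (fun k => ?_) ?_ ?_ ?_
  · simp only [Matrix.mul_apply]
    exact (Finset.measurable_sum _ fun l _ =>
      (ha i l).mul (measurable_peanoBaker_path ha k l j)).aestronglyMeasurable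
  · filter_upwards [ae_restrict_mem measurableSet_Ioc] with s hs
    refine abs_mul_apply_le (hC s) (fun i j => (abs_peanoBaker_le hC k hs.1.le i j).trans ?_) i j
    have hC0 : 0 ≤ C := (abs_nonneg _).trans (hC 0 i j)
    have := hs.1.le
    have := hs.2
    gcongr
  · exact Filter.Eventually.of_forall fun _ => (Real.summable_pow_div_factorial _).mul_left _
  · exact integrable_const _
  · filter_upwards [ae_restrict_mem measurableSet_Ioc] with s hs
    simp only [Matrix.mul_apply]
    exact hasSum_sum fun l _ => (summable_peanoBaker hC hs.1.le l j).hasSum.mul_left _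

theorem continuousOn_flow (ha : ∀ i j, Measurable fun s => a s i j)
    (hC : ∀ s i j, |a s i j| ≤ C) : ContinuousOn (flow a) (Set.Ici 0) := by
  refine continuousOn_pi.2 fun i => continuousOn_pi.2 fun j => ?_
  have hint : ∀ t, IntegrableOn (fun s => (a s * flow a s) i j) (Set.Icc 0 t) := fun t =>
    (integrableOn_Icc_iff_integrableOn_Ioc).2 (integrableOn_mul_flow ha hC t i j)
  intro t ht
  have h1 := (intervalIntegral.continuousOn_primitive (hint (t + 1))).const_add
    ((1 : Matrix (Fin n) (Fin n) ℝ) i j)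
  have h2 : ContinuousWithinAt (fun t => flow a t i j) (Set.Icc 0 (t + 1)) t :=
    (h1 t ⟨ht, by linarith⟩).congr (fun s hs => flow_eq ha hC hs.1 i j) (flow_eq ha hC ht i j)
  refine h2.mono_of_mem_nhdsWithin ?_
  exact Filter.mem_of_superset (inter_mem_nhdsWithin _ (Iio_mem_nhds (lt_add_one t)))
    fun s hs => ⟨hs.1, (le_of_lt hs.2)⟩

/-! ### Existence and uniqueness of solutions -/

theorem isTrajectory_flow (ha : ∀ i j, Measurable fun s => a s i j)
    (hC : ∀ s i j, |a s i j| ≤ C) (x₀ : Fin n → ℝ) :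
    IsTrajectory a x₀ fun t => flow a t *ᵥ x₀ := by
  have hmul : ∀ s i, (a s *ᵥ flow a s *ᵥ x₀) i = ∑ j, (a s * flow a s) i j * x₀ j := by
    intro s i
    rw [Matrix.mulVec_mulVec]
    rfl
  refine ⟨?_, fun t ht i => ?_, fun t ht i => ?_⟩
  · have := continuousOn_flow ha hC
    exact (Continuous.matrix_mulVec continuous_id continuous_const).comp_continuousOn this
  · rw [intervalIntegrable_iff_integrableOn_Ioc_of_le ht]
    simp only [hmul]
    exact integrable_finsetSum _ fun j _ => (integrableOn_mul_flow ha hC t i j).mul_const _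
  · rw [intervalIntegral.integral_of_le ht]
    simp only [hmul]
    rw [integral_finsetSum _ fun j _ => (integrableOn_mul_flow ha hC t i j).mul_const _]
    simp only [integral_mul_const]
    simp only [Matrix.mulVec, dotProduct, flow_eq ha hC ht i, add_mul, Finset.sum_add_distrib]
    congr 1
    have := congrFun (Matrix.one_mulVec x₀) i
    exact this

theorem isFundamental_flow (ha : ∀ i j, Measurable fun s => a s i j)
    (hC : ∀ s i j, |a s i j| ≤ C) : IsFundamental a 0 (flow a) := by
  refine ⟨continuousOn_flow ha hC, fun t ht i j => ?_, fun t ht i j => ?_⟩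
  · exact (intervalIntegrable_iff_integrableOn_Ioc_of_le ht).2 (integrableOn_mul_flow ha hC t i j)
  · rw [intervalIntegral.integral_of_le ht]
    exact flow_eq ha hC ht i j

theorem IsFundamental.isTrajectory {Φ : ℝ → Matrix (Fin n) (Fin n) ℝ} (h : IsFundamental a 0 Φ)
    (j : Fin n) : IsTrajectory a (fun i => (1 : Matrix (Fin n) (Fin n) ℝ) i j)
      fun t i => Φ t i j :=
  ⟨continuousOn_pi.2 fun i => (continuousOn_pi.1 (continuousOn_pi.1 h.continuousOn i) j),
    fun t ht i => h.intervalIntegrable t ht i j, fun t ht i => h.integral_eq t ht i j⟩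

theorem IsTrajectory.unique (hC : ∀ s i j, |a s i j| ≤ C) {x₀ : Fin n → ℝ}
    {x y : ℝ → Fin n → ℝ} (hx : IsTrajectory a x₀ x) (hy : IsTrajectory a x₀ y) {t : ℝ}
    (ht : 0 ≤ t) : x t = y t := by
  set d : ℝ → Fin n → ℝ := fun s => x s - y s with hd
  have hdc : ContinuousOn d (Set.Icc 0 t) :=
    (hx.continuousOn.sub hy.continuousOn).mono Set.Icc_subset_Ici_self
  obtain ⟨M, hM⟩ := isCompact_Icc.exists_bound_of_continuousOn hdc
  have heq : ∀ s, 0 ≤ s → ∀ i, d s i = ∫ r in Set.Ioc 0 s, (a r *ᵥ d r) i := by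
    intro s hs i
    change x s i - y s i = ∫ r in Set.Ioc 0 s, (a r *ᵥ (x r - y r)) i
    rw [hx.integral_eq s hs i, hy.integral_eq s hs i, add_sub_add_left_eq_sub,
      ← intervalIntegral.integral_sub (hx.intervalIntegrable s hs i)
        (hy.intervalIntegrable s hs i), intervalIntegral.integral_of_le hs]
    simp only [Matrix.mulVec_sub, Pi.sub_apply]
  have hbd : ∀ k : ℕ, ∀ s, 0 ≤ s → s ≤ t → ∀ i,
      |d s i| ≤ M * ((n * C * s) ^ k / k.factorial) := by
    intro k
    induction k with
    | zero =>
      intro s hs hst i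
      simpa using (norm_le_pi_norm (d s) i).trans (hM s ⟨hs, hst⟩)
    | succ k ih =>
      intro s hs hst i
      rw [heq s hs i]
      refine abs_setIntegral_Ioc_le hs fun r hr hrs => ?_
      have hC0 : 0 ≤ C := (abs_nonneg _).trans (hC 0 i i)
      calc |(a r *ᵥ d r) i| ≤ ∑ j, |a r i j * d r j| :=
            Finset.abs_sum_le_sum_abs (fun j => a r i j * d r j) Finset.univ
        _ ≤ ∑ _j : Fin n, C * (M * ((n * C * r) ^ k / k.factorial)) :=
            Finset.sum_le_sum fun j _ => by
              rw [abs_mul]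
              exact mul_le_mul (hC r i j) (ih r hr (hrs.trans hst) j) (abs_nonneg _) hC0
        _ = _ := by simp [mul_assoc]
  have hz : d t = 0 := by
    funext i
    have h1 : Filter.Tendsto (fun k : ℕ => M * ((n * C * t) ^ k / k.factorial)) Filter.atTop
        (nhds (M * 0)) := (FloorSemiring.tendsto_pow_div_factorial_atTop _).const_mul M
    rw [mul_zero] at h1
    exact abs_nonpos_iff.1 (ge_of_tendsto' h1 fun k => hbd k t ht le_rfl i)
  exact sub_eq_zero.1 hz

theorem trajectory_eq (ha : ∀ i j, Measurable fun s => a s i j)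
    (hC : ∀ s i j, |a s i j| ≤ C) (x₀ : Fin n → ℝ) {t : ℝ} (ht : 0 ≤ t) :
    trajectory a x₀ t = flow a t *ᵥ x₀ :=
  (Classical.epsilon_spec (p := IsTrajectory a x₀) ⟨_, isTrajectory_flow ha hC x₀⟩).unique hC
    (isTrajectory_flow ha hC x₀) ht

theorem fundamentalMatrix_eq (ha : ∀ i j, Measurable fun s => a s i j)
    (hC : ∀ s i j, |a s i j| ≤ C) {t : ℝ} (ht : 0 ≤ t) : fundamentalMatrix a 0 t = flow a t := by
  have h := Classical.epsilon_spec (p := IsFundamental a 0) ⟨_, isFundamental_flow ha hC⟩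
  ext i j
  exact congrFun ((h.isTrajectory j).unique hC ((isFundamental_flow ha hC).isTrajectory j) ht) i

/-- The flow after the time `r` is the flow of the shifted coefficient. -/
theorem flow_add (ha : ∀ i j, Measurable fun s => a s i j) (hC : ∀ s i j, |a s i j| ≤ C)
    {r t : ℝ} (hr : 0 ≤ r) (ht : 0 ≤ t) {b : ℝ → Matrix (Fin n) (Fin n) ℝ}
    (hb : ∀ i j, Measurable fun s => b s i j) (hbC : ∀ s i j, |b s i j| ≤ C)
    (hab : ∀ s, 0 ≤ s → b s = a (s + r)) : flow a (t + r) = flow b t * flow a r := by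
  refine Matrix.ext_of_mulVec_single fun j => ?_
  rw [← Matrix.mulVec_mulVec]
  set x₀ : Fin n → ℝ := Pi.single j 1
  have h := isTrajectory_flow ha hC x₀
  have hcongr : ∀ s, 0 ≤ s → ∀ i, Set.EqOn (fun u => (b u *ᵥ flow a (u + r) *ᵥ x₀) i)
      (fun u => (a (u + r) *ᵥ flow a (u + r) *ᵥ x₀) i) (Set.uIcc 0 s) := by
    intro s hs i u hu
    rw [Set.uIcc_of_le hs] at hu
    simp only [hab u hu.1]
  have hsh : IsTrajectory b (flow a r *ᵥ x₀) fun s => flow a (s + r) *ᵥ x₀ := by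
    refine ⟨?_, fun s hs i => ?_, fun s hs i => ?_⟩
    · exact h.continuousOn.comp (by fun_prop) fun s hs => add_nonneg hs hr
    · have h1 : IntervalIntegrable (fun u => (a u *ᵥ flow a u *ᵥ x₀) i) volume r (s + r) :=
        (h.intervalIntegrable r hr i).symm.trans (h.intervalIntegrable (s + r) (by positivity) i)
      have h2 := h1.comp_add_right r
      simp only [sub_self, add_sub_cancel_right] at h2
      exact h2.congr (((hcongr s hs i).mono Set.uIoc_subset_uIcc).symm)
    · rw [intervalIntegral.integral_congr (hcongr s hs i),
        intervalIntegral.integral_comp_add_right (fun u => (a u *ᵥ flow a u *ᵥ x₀) i),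
        zero_add, h.integral_eq r hr i, h.integral_eq (s + r) (by positivity) i, add_assoc,
        intervalIntegral.integral_add_adjacent_intervals (h.intervalIntegrable r hr i)]
      exact (h.intervalIntegrable r hr i).symm.trans
        (h.intervalIntegrable (s + r) (by positivity) i)
  exact hsh.unique hbC (isTrajectory_flow hb hbC _) ht

/-- Stopping the coefficient at the time `r` freezes the flow at `Φ(r)`. -/
theorem flow_stopped (ha : ∀ i j, Measurable fun s => a s i j) (hC : ∀ s i j, |a s i j| ≤ C)
    {r t : ℝ} (hr : 0 ≤ r) (hrt : r ≤ t) :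
    flow (fun s => if s < r then a s else 0) t = flow a r := by
  set b : ℝ → Matrix (Fin n) (Fin n) ℝ := fun s => if s < r then a s else 0 with hb
  have hbm : ∀ i j, Measurable fun s => b s i j := fun i j => by
    have : (fun s => b s i j) = fun s => if s < r then a s i j else 0 := by
      funext s; simp only [hb]; split_ifs <;> rfl
    rw [this]
    exact Measurable.ite measurableSet_Iio (ha i j) measurable_const
  have hbC : ∀ s i j, |b s i j| ≤ C := fun s i j => by
    simp only [hb]
    split_ifs
    · exact hC s i j
    · simpa using (abs_nonneg _).trans (hC s i j)
  have hz : ∀ s, 0 ≤ s → (fun _ : ℝ => (0 : Matrix (Fin n) (Fin n) ℝ)) s = b (s + r) := by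
    intro s hs
    simp [hb, hs]
  have h1 := flow_add hbm hbC hr (sub_nonneg.2 hrt) (b := fun _ => 0) (by simp)
    (fun s i j => (by simpa using (abs_nonneg _).trans (hC s i j))) hz
  have hC' : ∀ (s : ℝ) (i j : Fin n), |(0 : Matrix (Fin n) (Fin n) ℝ) i j| ≤ 0 := by simp
  have h2 : flow (fun _ : ℝ => (0 : Matrix (Fin n) (Fin n) ℝ)) (t - r) = 1 := by
    ext i j
    rw [flow_eq (C := 0) (by simp) hC' (sub_nonneg.2 hrt)]
    simp
  rw [sub_add_cancel, h2, one_mul] at h1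
  rw [h1]
  -- Up to the time `r` both coefficients have the same Peano–Baker terms.
  have h3 : ∀ k s, 0 ≤ s → s ≤ r → peanoBaker b k s = peanoBaker a k s := by
    intro k
    induction k with
    | zero => intros; rfl
    | succ k ih =>
      intro s hs hsr
      ext i j
      simp only [peanoBaker, Matrix.of_apply]
      rw [integral_Ioc_eq_integral_Ioo, integral_Ioc_eq_integral_Ioo]
      refine setIntegral_congr_fun measurableSet_Ioo fun u hu => ?_
      simp only [hb, if_pos (hu.2.trans_le hsr)]
      rw [ih u hu.1.le (hu.2.le.trans hsr)]
  ext i j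
  simp only [flow, Matrix.of_apply, h3 _ r hr le_rfl]

end Path

/-! ### Measurability of solutions with respect to the driving process -/

section Conditioning

variable {X : Type*} {𝒢 mX : MeasurableSpace X} {μ : Measure X}

/-- The error of conditioning on `𝒢` is orthogonal to bounded `𝒢`-measurable functions. -/
theorem integral_mul_sub_condExp_eq_zero [IsFiniteMeasure μ] (h𝒢 : 𝒢 ≤ mX) {g Y : X → ℝ}
    (hg : AEStronglyMeasurable[𝒢] g μ) {C : ℝ} (hC : ∀ᵐ x ∂μ, |g x| ≤ C) (hY : Integrable Y μ) :
    ∫ x, g x * (Y x - (μ[Y | 𝒢]) x) ∂μ = 0 := by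
  have hW : Integrable (Y - μ[Y | 𝒢]) μ := hY.sub integrable_condExp
  have hgW : Integrable (g * (Y - μ[Y | 𝒢])) μ := hW.bdd_mul (hg.mono h𝒢) hC
  have h0 : μ[Y - μ[Y | 𝒢] | 𝒢] =ᵐ[μ] 0 := by
    refine (condExp_sub hY integrable_condExp 𝒢).trans ?_
    rw [condExp_of_stronglyMeasurable h𝒢 stronglyMeasurable_condExp integrable_condExp, sub_self]
  have h1 := condExp_mul_of_aestronglyMeasurable_left hg hgW hW
  calc ∫ x, g x * (Y x - (μ[Y | 𝒢]) x) ∂μ = ∫ x, (μ[g * (Y - μ[Y | 𝒢]) | 𝒢]) x ∂μ :=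
        (integral_condExp h𝒢).symm
    _ = ∫ _x, (0 : ℝ) ∂μ := integral_congr_ae (by
        filter_upwards [h0, h1] with x hx0 hx1
        rw [hx1, Pi.mul_apply, hx0, Pi.zero_apply, mul_zero])
    _ = 0 := by simp

/-- A time integral of random variables that are measurable with respect to `𝒢` up to null sets is
again so, although the integrand need not be jointly measurable for `𝒢`: it is orthogonal to the
error of conditioning it on `𝒢`, by Fubini's theorem. -/
theorem aestronglyMeasurable_setIntegral_Ioc [IsFiniteMeasure μ] (h𝒢 : 𝒢 ≤ mX)
    {f : ℝ × X → ℝ} (hf : Measurable f) {t C : ℝ}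
    (hC : ∀ s ∈ Set.Ioc 0 t, ∀ x, |f (s, x)| ≤ C)
    (hm : ∀ s ∈ Set.Ioc 0 t, AEStronglyMeasurable[𝒢] (fun x => f (s, x)) μ) :
    AEStronglyMeasurable[𝒢] (fun x => ∫ s in Set.Ioc 0 t, f (s, x)) μ := by
  set Y : X → ℝ := fun x => ∫ s in Set.Ioc 0 t, f (s, x) with hYdef
  set D : ℝ := C * volume.real (Set.Ioc 0 t)
  have hYm : Measurable Y :=
    (measurable_setIntegral_Ioc hf).comp (measurable_const.prodMk measurable_id)
  have hYb : ∀ x, |Y x| ≤ D := fun x => by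
    rw [← Real.norm_eq_abs]
    exact norm_setIntegral_le_of_norm_le_const measure_Ioc_lt_top fun s hs => hC s hs x
  have hY : Integrable Y μ :=
    Integrable.of_bound hYm.aestronglyMeasurable D (Filter.Eventually.of_forall hYb)
  have hEb : ∀ᵐ x ∂μ, |(μ[Y | 𝒢]) x| ≤ D.toNNReal :=
    ae_bdd_abs_condExp_of_ae_bdd_abs (Filter.Eventually.of_forall fun x =>
      (hYb x).trans (Real.le_coe_toNNReal D))
  set W : X → ℝ := fun x => Y x - (μ[Y | 𝒢]) x with hWdef
  have hW : Integrable W μ := hY.sub integrable_condExp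
  have h1 : ∫ x, (μ[Y | 𝒢]) x * W x ∂μ = 0 :=
    integral_mul_sub_condExp_eq_zero h𝒢 stronglyMeasurable_condExp.aestronglyMeasurable hEb hY
  have h2 : ∫ x, Y x * W x ∂μ = 0 := by
    have hint : Integrable (fun p : ℝ × X => f p * W p.2)
        ((volume.restrict (Set.Ioc 0 t)).prod μ) := by
      refine (hW.comp_snd _).bdd_mul (c := C) hf.aestronglyMeasurable ?_
      refine (ae_of_ae_map (f := Prod.fst) (p := fun s => s ∈ Set.Ioc 0 t)
        measurable_fst.aemeasurable ?_).mono fun p hp => hC p.1 hp p.2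
      rw [Measure.map_fst_prod]
      exact Measure.ae_smul_measure (ae_restrict_mem measurableSet_Ioc) _
    calc ∫ x, Y x * W x ∂μ = ∫ x, ∫ s in Set.Ioc 0 t, f (s, x) * W x ∂volume ∂μ := by
          simp only [hYdef, integral_mul_const]
      _ = ∫ s in Set.Ioc 0 t, ∫ x, f (s, x) * W x ∂μ :=
          (integral_integral_swap (f := fun s x => f (s, x) * W x) hint).symm
      _ = ∫ s in Set.Ioc 0 t, (0 : ℝ) := setIntegral_congr_fun measurableSet_Ioc fun s hs =>
          integral_mul_sub_condExp_eq_zero h𝒢 (hm s hs)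
            (Filter.Eventually.of_forall (hC s hs)) hY
      _ = 0 := by simp
  have hYW : Integrable (fun x => Y x * W x) μ :=
    hW.bdd_mul hYm.aestronglyMeasurable (Filter.Eventually.of_forall hYb)
  have hEW : Integrable (fun x => (μ[Y | 𝒢]) x * W x) μ :=
    hW.bdd_mul integrable_condExp.aestronglyMeasurable hEb
  have h3 : ∫ x, W x * W x ∂μ = 0 := by
    have h5 : ∀ x, W x * W x = Y x * W x - (μ[Y | 𝒢]) x * W x := fun x => sub_mul _ _ _
    simp only [h5]
    rw [integral_sub hYW hEW, h1, h2, sub_zero]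
  have h4 : (fun x => W x * W x) =ᵐ[μ] 0 := by
    refine (integral_eq_zero_iff_of_nonneg (fun x => mul_self_nonneg _) ?_).1 h3
    refine (hYW.sub hEW).congr (Filter.Eventually.of_forall fun x => ?_)
    simp only [hWdef, Pi.sub_apply]
    ring
  refine ⟨μ[Y | 𝒢], stronglyMeasurable_condExp, h4.mono fun x hx => ?_⟩
  exact sub_eq_zero.1 (mul_self_eq_zero.1 hx)

variable {n : ℕ} {a : X → ℝ → Matrix (Fin n) (Fin n) ℝ} {C : ℝ}

theorem aestronglyMeasurable_sum_of_le {ι : Type*} {f : ι → X → ℝ} (s : Finset ι)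
    (hf : ∀ i, AEStronglyMeasurable[𝒢] (f i) μ) :
    AEStronglyMeasurable[𝒢] (fun x => ∑ i ∈ s, f i x) μ := by
  choose g hg hfg using hf
  refine ⟨fun x => ∑ i ∈ s, g i x, Finset.stronglyMeasurable_fun_sum _ fun i _ => hg i, ?_⟩
  have h : ∀ i ∈ s, f i =ᵐ[μ] g i := fun i _ => hfg i
  filter_upwards [(Filter.eventually_all_finset s).2 h] with x hx
  exact Finset.sum_congr rfl hx

theorem stronglyMeasurable_limUnder_sum {Y : Type*} {mY : MeasurableSpace Y} {g : ℕ → Y → ℝ}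
    (hg : ∀ k, StronglyMeasurable (g k)) : StronglyMeasurable fun x =>
      Filter.limUnder Filter.atTop fun N : ℕ => ∑ k ∈ Finset.range N, g k x :=
  StronglyMeasurable.limUnder fun _ => Finset.stronglyMeasurable_fun_sum _ fun k _ => hg k

theorem aestronglyMeasurable_of_hasSum_of_le {f : ℕ → X → ℝ} {F : X → ℝ}
    (hf : ∀ k, AEStronglyMeasurable[𝒢] (f k) μ) (hF : ∀ x, HasSum (fun k => f k x) (F x)) :
    AEStronglyMeasurable[𝒢] F μ := by
  choose g hg hfg using hf
  refine ⟨_, stronglyMeasurable_limUnder_sum hg, ?_⟩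
  filter_upwards [ae_all_iff.2 hfg] with x hx
  have h := (hF x).tendsto_sum_nat
  simp only [hx] at h
  exact h.limUnder_eq.symm

theorem aestronglyMeasurable_peanoBaker [IsFiniteMeasure μ] (h𝒢 : 𝒢 ≤ mX)
    (ha : ∀ i j, Measurable fun p : ℝ × X => a p.2 p.1 i j) (hC : ∀ x s i j, |a x s i j| ≤ C)
    (ha𝒢 : ∀ s, 0 ≤ s → ∀ i j, AEStronglyMeasurable[𝒢] (fun x => a x s i j) μ) (k : ℕ) (t : ℝ)
    (i j : Fin n) : AEStronglyMeasurable[𝒢] (fun x => peanoBaker (a x) k t i j) μ := by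
  induction k generalizing t i j with
  | zero => exact aestronglyMeasurable_const
  | succ k ih =>
    refine aestronglyMeasurable_setIntegral_Ioc h𝒢
      (f := fun p : ℝ × X => (a p.2 p.1 * peanoBaker (a p.2) k p.1) i j)
      (C := n * C * ((n * C * t) ^ k / k.factorial)) ?_ (fun s hs x => ?_) fun s hs => ?_
    · simp only [Matrix.mul_apply]
      exact Finset.measurable_sum _ fun l _ => (ha i l).mul (measurable_peanoBaker ha k l j)
    · refine abs_mul_apply_le (hC x s) (fun i j =>
        (abs_peanoBaker_le (hC x) k hs.1.le i j).trans ?_) i j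
      have hC0 : 0 ≤ C := (abs_nonneg _).trans (hC x 0 i j)
      have := hs.1.le
      have := hs.2
      gcongr
    · simp only [Matrix.mul_apply]
      exact aestronglyMeasurable_sum_of_le _ fun l => (ha𝒢 s hs.1.le i l).mul (ih s l j)

theorem aestronglyMeasurable_flow [IsFiniteMeasure μ] (h𝒢 : 𝒢 ≤ mX)
    (ha : ∀ i j, Measurable fun p : ℝ × X => a p.2 p.1 i j) (hC : ∀ x s i j, |a x s i j| ≤ C)
    (ha𝒢 : ∀ s, 0 ≤ s → ∀ i j, AEStronglyMeasurable[𝒢] (fun x => a x s i j) μ) {t : ℝ}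
    (ht : 0 ≤ t) (i j : Fin n) : AEStronglyMeasurable[𝒢] (fun x => flow (a x) t i j) μ :=
  aestronglyMeasurable_of_hasSum_of_le
    (fun k => aestronglyMeasurable_peanoBaker h𝒢 ha hC ha𝒢 k t i j)
    fun x => (summable_peanoBaker (hC x) ht i j).hasSum

end Conditioning

/-! ### The random flow and the regeneration of its lift -/

theorem measurable_matLift {X : Type*} {mX : MeasurableSpace X} {n m : ℕ}
    {M : X → Matrix (Fin n) (Fin n) ℝ} (hM : ∀ i j, Measurable fun x => M x i j)
    (α β : Exponent n m) : Measurable fun x => matLift m (M x) α β := by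
  have h : Measurable fun M : Fin n → Fin n → ℝ => matLift m (Matrix.of M) α β :=
    ((continuous_matLift α β).comp (continuous_id (X := Fin n → Fin n → ℝ))).measurable
  exact h.comp (f := fun x i j => M x i j)
    (measurable_pi_lambda _ fun i => measurable_pi_lambda _ fun j => hM i j)

/-- The coefficient stopped at the epoch `R` only depends on the first cycle. -/
theorem measurable_stopped_coefficient {Ω S : Type*} [MeasurableSpace S] {n : ℕ}
    {A : S → Matrix (Fin n) (Fin n) ℝ} {σ : ℝ≥0 → Ω → S} {R : Ω → ℝ≥0}
    (hA : ∀ i j, Measurable fun s => A s i j) {t : ℝ}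
    (ht : 0 ≤ t) (i j : Fin n) : Measurable[cycleSigmaAlgebra σ R] fun ω =>
      (if t < R ω then coefficient A σ ω t else 0) i j := by
  intro B hB
  have hR : MeasurableSet[cycleSigmaAlgebra σ R] {ω | t.toNNReal < R ω} :=
    (le_sup_left : _ ≤ cycleSigmaAlgebra σ R) _ ⟨Set.Ioi t.toNNReal, measurableSet_Ioi, rfl⟩
  have hE : MeasurableSet[cycleSigmaAlgebra σ R]
      {ω | t.toNNReal < R ω ∧ σ t.toNNReal ω ∈ (fun s => A s i j) ⁻¹' B} :=
    (le_sup_right : _ ≤ cycleSigmaAlgebra σ R) _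
      (MeasurableSpace.measurableSet_generateFrom ⟨t.toNNReal, _, hA i j hB, rfl⟩)
  have hlt : ∀ ω, t < R ω ↔ t.toNNReal < R ω := fun ω =>
    (Real.toNNReal_lt_iff_lt_coe ht).symm
  have heq : (fun ω => (if t < R ω then coefficient A σ ω t else 0) i j) ⁻¹' B =
      {ω | t.toNNReal < R ω ∧ σ t.toNNReal ω ∈ (fun s => A s i j) ⁻¹' B} ∪
        ({ω | t.toNNReal < R ω}ᶜ ∩ {_ω | (0 : ℝ) ∈ B}) := by
    ext ω
    by_cases h : t < R ω
    · simp [h, (hlt ω).1 h, coefficient]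
    · have h' := mt (hlt ω).2 h
      simp [h, h']
  rw [heq]
  exact hE.union (hR.compl.inter (MeasurableSet.const _))

section RandomFlow

variable {Ω S : Type*} [MeasurableSpace Ω] [MeasurableSpace S] {P : Measure Ω}
  {n : ℕ} {A : S → Matrix (Fin n) (Fin n) ℝ} {C : ℝ} {σ : ℝ≥0 → Ω → S} {R : Ω → ℝ≥0}

theorem measurable_coefficient (hA : ∀ i j, Measurable fun s => A s i j)
    (hσ : Measurable fun p : ℝ≥0 × Ω => σ p.1 p.2) (i j : Fin n) :
    Measurable fun p : ℝ × Ω => coefficient A σ p.2 p.1 i j :=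
  (hA i j).comp (hσ.comp ((measurable_real_toNNReal.comp measurable_fst).prodMk measurable_snd))

theorem measurable_coefficient_path (hA : ∀ i j, Measurable fun s => A s i j)
    (hσ : Measurable fun p : ℝ≥0 × Ω => σ p.1 p.2) (ω : Ω) (i j : Fin n) :
    Measurable fun t => coefficient A σ ω t i j :=
  (measurable_coefficient hA hσ i j).comp (measurable_id.prodMk measurable_const)

theorem state_eq (hA : ∀ i j, Measurable fun s => A s i j) (hC : ∀ s i j, |A s i j| ≤ C)
    (hσ : Measurable fun p : ℝ≥0 × Ω => σ p.1 p.2) (x₀ : Fin n → ℝ) {t : ℝ} (ht : 0 ≤ t)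
    (ω : Ω) : state A σ x₀ t ω = flow (coefficient A σ ω) t *ᵥ x₀ :=
  trajectory_eq (measurable_coefficient_path hA hσ ω) (fun _ => hC _) x₀ ht

theorem firstCycleMatrix_eq (hA : ∀ i j, Measurable fun s => A s i j)
    (hC : ∀ s i j, |A s i j| ≤ C) (hσ : Measurable fun p : ℝ≥0 × Ω => σ p.1 p.2) (ω : Ω) :
    firstCycleMatrix A σ R ω = flow (coefficient A σ ω) (R ω) :=
  fundamentalMatrix_eq (measurable_coefficient_path hA hσ ω) (fun _ => hC _) (R ω).coe_nonneg

theorem measurable_randomFlow (hA : ∀ i j, Measurable fun s => A s i j)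
    (hC : ∀ s i j, |A s i j| ≤ C) (hσ : Measurable fun p : ℝ≥0 × Ω => σ p.1 p.2) :
    ∀ i j, Measurable fun p : ℝ × Ω => flow (coefficient A σ p.2) p.1 i j :=
  measurable_flow (measurable_coefficient hA hσ) fun _ _ => hC _

theorem measurable_process (hσ : Measurable fun p : ℝ≥0 × Ω => σ p.1 p.2) (t : ℝ≥0) :
    Measurable (σ t) :=
  hσ.comp (measurable_const.prodMk measurable_id)

theorem measurable_shifted_process (hσ : Measurable fun p : ℝ≥0 × Ω => σ p.1 p.2)
    (hR : Measurable R) : Measurable fun p : ℝ≥0 × Ω => shiftedPath σ R p.2 p.1 :=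
  hσ.comp ((measurable_fst.add (hR.comp measurable_snd)).prodMk measurable_snd)

/-- The flow splits at `R` into the first cycle and the flow driven by the shifted process. -/
theorem flow_add_epoch (hA : ∀ i j, Measurable fun s => A s i j)
    (hC : ∀ s i j, |A s i j| ≤ C) (hσ : Measurable fun p : ℝ≥0 × Ω => σ p.1 p.2)
    (hR : Measurable R) {t : ℝ} (ht : 0 ≤ t) (ω : Ω) :
    flow (coefficient A σ ω) (t + R ω) =
      flow (coefficient A (fun t ω => shiftedPath σ R ω t) ω) t *
        flow (coefficient A σ ω) (R ω) := by
  refine flow_add (measurable_coefficient_path hA hσ ω) (fun _ => hC _) (R ω).coe_nonneg ht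
    (measurable_coefficient_path hA (measurable_shifted_process hσ hR) ω) (fun _ => hC _)
    fun s hs => ?_
  have h : (s + R ω).toNNReal = s.toNNReal + R ω := by
    rw [Real.toNNReal_add hs (R ω).coe_nonneg, Real.toNNReal_coe]
  rw [coefficient, coefficient, h, shiftedPath]

theorem cycleSigmaAlgebra_le (hσ : Measurable fun p : ℝ≥0 × Ω => σ p.1 p.2)
    (hR : Measurable R) : cycleSigmaAlgebra σ R ≤ ‹MeasurableSpace Ω› := by
  refine sup_le hR.comap_le (MeasurableSpace.generateFrom_le ?_)
  rintro _ ⟨t, B, hB, rfl⟩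
  exact (measurableSet_lt measurable_const hR).inter (measurable_process hσ t hB)

theorem aestronglyMeasurable_firstCycle [IsProbabilityMeasure P]
    (hA : ∀ i j, Measurable fun s => A s i j) (hC : ∀ s i j, |A s i j| ≤ C)
    (hσ : Measurable fun p : ℝ≥0 × Ω => σ p.1 p.2) (hR : Measurable R) {T : ℝ≥0}
    (hT : ∀ᵐ ω ∂P, R ω ≤ T) (i j : Fin n) :
    AEStronglyMeasurable[cycleSigmaAlgebra σ R]
      (fun ω => flow (coefficient A σ ω) (R ω) i j) P := by
  have h := aestronglyMeasurable_flow (μ := P) (C := C) (cycleSigmaAlgebra_le hσ hR)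
    (a := fun ω s => if s < R ω then coefficient A σ ω s else 0) (t := T)
    (fun i j => ?_) (fun ω s i j => ?_)
    (fun s hs i j =>
      (measurable_stopped_coefficient hA hs i j).stronglyMeasurable.aestronglyMeasurable)
    T.2 i j
  · refine h.congr (hT.mono fun ω hω => ?_)
    have := flow_stopped (measurable_coefficient_path hA hσ ω) (fun _ => hC _) (R ω).coe_nonneg
      (NNReal.coe_le_coe.2 hω)
    exact congrFun (congrFun this i) j
  · have : (fun p : ℝ × Ω => (if p.1 < R p.2 then coefficient A σ p.2 p.1 else 0) i j) =
        fun p => if p.1 < (R p.2 : ℝ) then coefficient A σ p.2 p.1 i j else 0 := by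
      funext p; split_ifs <;> rfl
    rw [this]
    exact Measurable.ite (measurableSet_lt measurable_fst (by fun_prop))
      (measurable_coefficient hA hσ i j) measurable_const
  · split_ifs
    · exact hC _ i j
    · simpa using (abs_nonneg _).trans (hC (σ 0 ω) i j)

/-- Two processes on the same space drive flows that are, almost surely, one and the same
measurable functional of the two sample paths. The processes are glued to one process on
`Bool × Ω`, whose flow is measurable with respect to its path up to null sets. -/
theorem exists_path_functional [IsProbabilityMeasure P]
    (hA : ∀ i j, Measurable fun s => A s i j) (hC : ∀ s i j, |A s i j| ≤ C)
    {τ : ℝ≥0 → Ω → S} (hσ : Measurable fun p : ℝ≥0 × Ω => σ p.1 p.2)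
    (hτ : Measurable fun p : ℝ≥0 × Ω => τ p.1 p.2) {t : ℝ} (ht : 0 ≤ t) :
    ∃ G : (ℝ≥0 → S) → Matrix (Fin n) (Fin n) ℝ, (∀ i j, Measurable fun p => G p i j) ∧
      (∀ᵐ ω ∂P, flow (coefficient A σ ω) t = G fun s => σ s ω) ∧
      ∀ᵐ ω ∂P, flow (coefficient A τ ω) t = G fun s => τ s ω := by
  set ρ : ℝ≥0 → Bool × Ω → S := fun s x => if x.1 = true then σ s x.2 else τ s x.2 with hρdef
  have hρ : Measurable fun p : ℝ≥0 × (Bool × Ω) => ρ p.1 p.2 := by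
    refine Measurable.ite ?_ (hσ.comp (g := fun p : ℝ≥0 × Ω => σ p.1 p.2)
      (f := fun p : ℝ≥0 × (Bool × Ω) => (p.1, p.2.2)) (by fun_prop))
      (hτ.comp (g := fun p : ℝ≥0 × Ω => τ p.1 p.2)
      (f := fun p : ℝ≥0 × (Bool × Ω) => (p.1, p.2.2)) (by fun_prop))
    exact (measurable_fst.comp measurable_snd) (measurableSet_singleton true)
  set path : Bool × Ω → ℝ≥0 → S := fun x s => ρ s x
  have hpath : Measurable path := measurable_pi_lambda _ fun s => measurable_process hρ s
  have hmeas : ∀ i j, AEStronglyMeasurable[MeasurableSpace.comap path MeasurableSpace.pi]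
      (fun x => flow (coefficient A ρ x) t i j) ((Measure.count : Measure Bool).prod P) := by
    refine fun i j => aestronglyMeasurable_flow hpath.comap_le (measurable_coefficient hA hρ)
      (fun _ _ => hC _) (fun s hs i j => ?_) ht i j
    refine Measurable.aestronglyMeasurable ?_
    exact (hA i j).comp ((measurable_pi_apply s.toNNReal).comp (comap_measurable path))
  choose g hg hgeq using hmeas
  choose G hG hGeq using fun i j => (hg i j).measurable.exists_eq_measurable_comp
  have hall : ∀ᵐ x ∂((Measure.count : Measure Bool).prod P), ∀ i j,
      flow (coefficient A ρ x) t i j = G i j (path x) := by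
    simp only [ae_all_iff]
    intro i j
    filter_upwards [hgeq i j] with x hx
    rw [hx, hGeq i j]
    rfl
  have hb := Measure.ae_count_iff.1 (Measure.ae_ae_of_ae_prod hall)
  refine ⟨fun p => Matrix.of fun i j => G i j p, hG, (hb true).mono fun ω hω => ?_,
    (hb false).mono fun ω hω => ?_⟩
  · exact Matrix.ext hω
  · exact Matrix.ext hω

/-- The matrix `E[Φ(t)^[m]]` of the entrywise expectations. -/
noncomputable def meanLift (P : Measure Ω) (A : S → Matrix (Fin n) (Fin n) ℝ) (σ : ℝ≥0 → Ω → S)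
    (m : ℕ) (t : ℝ) : Matrix (Exponent n m) (Exponent n m) ℝ :=
  fun α β => ∫ ω, matLift m (flow (coefficient A σ ω) t) α β ∂P

theorem measurable_matLift_flow (hA : ∀ i j, Measurable fun s => A s i j)
    (hC : ∀ s i j, |A s i j| ≤ C) (hσ : Measurable fun p : ℝ≥0 × Ω => σ p.1 p.2)
    {m : ℕ} (α β : Exponent n m) :
    Measurable fun p : ℝ × Ω => matLift m (flow (coefficient A σ p.2) p.1) α β :=
  measurable_matLift (measurable_randomFlow hA hC hσ) α β

theorem integrable_matLift_flow [IsProbabilityMeasure P]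
    (hA : ∀ i j, Measurable fun s => A s i j)
    (hC : ∀ s i j, |A s i j| ≤ C) (hσ : Measurable fun p : ℝ≥0 × Ω => σ p.1 p.2)
    {m : ℕ} (α β : Exponent n m) {θ : Ω → ℝ} (hθ : Measurable θ) {T : ℝ}
    (hT : ∀ᵐ ω ∂P, 0 ≤ θ ω ∧ θ ω ≤ T) :
    Integrable (fun ω => matLift m (flow (coefficient A σ ω) (θ ω)) α β) P := by
  obtain ⟨D, hD⟩ := exists_abs_matLift_le_of_abs_le (Real.exp_pos (n * C * T)).le α β
  refine Integrable.of_bound ((measurable_matLift_flow hA hC hσ α β).comp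
    (hθ.prodMk measurable_id)).aestronglyMeasurable D ?_
  filter_upwards [hT] with ω hω
  exact hD _ fun i j => abs_flow_le_of_le (fun _ => hC _) hω.1 hω.2 i j

/-- The renewal identity for the expected lift: the first cycle is independent of the flow of the
shifted process, which has the same law as the flow of the original process. -/
theorem integral_matLift_flow_add_epoch [IsProbabilityMeasure P]
    (hA : ∀ i j, Measurable fun s => A s i j)
    (hC : ∀ s i j, |A s i j| ≤ C) (hσ : Measurable fun p : ℝ≥0 × Ω => σ p.1 p.2)
    (hR : IsRegenerationEpoch P σ R) {T : ℝ≥0} (hT : ∀ᵐ ω ∂P, R ω ≤ T) {m : ℕ}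
    {t : ℝ} (ht : 0 ≤ t) (α β : Exponent n m) :
    ∫ ω, matLift m (flow (coefficient A σ ω) (t + R ω)) α β ∂P =
      (meanLift P A σ m t * expectedLift P A σ R m) α β := by
  have hτ := measurable_shifted_process hσ hR.measurable
  obtain ⟨G, hG, hGσ, hGτ⟩ := exists_path_functional (P := P)
    (τ := fun t ω => shiftedPath σ R ω t) hA hC hσ hτ ht
  set L : Exponent n m → Exponent n m → (ℝ≥0 → S) → ℝ := fun α γ p => matLift m (G p) α γ
  have hL : ∀ α γ, Measurable (L α γ) := measurable_matLift hG
  -- The first cycle is replaced by a version that is measurable for the σ-algebra of the cycle.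
  choose z hz hzeq using aestronglyMeasurable_firstCycle hA hC hσ hR.measurable hT
  set Z : Exponent n m → Exponent n m → Ω → ℝ := fun γ β ω =>
    matLift m (Matrix.of fun i j => z i j ω) γ β
  have hZm : ∀ γ β, Measurable[cycleSigmaAlgebra σ R] (Z γ β) := 
    measurable_matLift fun i j => (hz i j).measurable
  have hZ : ∀ᵐ ω ∂P, ∀ γ β, Z γ β ω = matLift m (flow (coefficient A σ ω) (R ω)) γ β := by
    have : ∀ᵐ ω ∂P, ∀ i j, flow (coefficient A σ ω) (R ω) i j = z i j ω := by
      simp only [ae_all_iff]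
      exact hzeq
    filter_upwards [this] with ω hω γ β
    have : (Matrix.of fun i j => z i j ω) = flow (coefficient A σ ω) (R ω) := by
      ext i j; exact (hω i j).symm
    simp only [Z, this]
  have hindep : ∀ γ, IndepFun (fun ω => L α γ (shiftedPath σ R ω)) (Z γ β) P := fun γ => by
    rw [IndepFun_iff_Indep]
    refine indep_of_indep_of_le_right (indep_of_indep_of_le_left hR.indep ?_) (hZm γ β).comap_le
    exact ((hL α γ).comp (comap_measurable (shiftedPath σ R))).comap_le
  have hLint : ∀ γ, ∫ ω, L α γ (shiftedPath σ R ω) ∂P = meanLift P A σ m t α γ := fun γ => by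
    refine (hR.identDistrib.comp (hL α γ)).integral_eq.trans ?_
    refine integral_congr_ae (hGσ.mono fun ω hω => ?_)
    simp only [Function.comp_apply, L, hω]
  have hZint : ∀ γ, ∫ ω, Z γ β ω ∂P = expectedLift P A σ R m γ β := fun γ => by
    refine integral_congr_ae (hZ.mono fun ω hω => ?_)
    simp only [firstCycleMatrix_eq hA hC hσ]
    exact hω γ β
  have hsplit : ∀ᵐ ω ∂P, matLift m (flow (coefficient A σ ω) (t + R ω)) α β =
      ∑ γ, L α γ (shiftedPath σ R ω) * Z γ β ω := by
    filter_upwards [hGτ, hZ] with ω hω hω'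
    rw [flow_add_epoch hA hC hσ hR.measurable ht, matLift_mul, Matrix.mul_apply]
    refine Finset.sum_congr rfl fun γ _ => ?_
    rw [hω' γ β, hω]
  have hLi : ∀ γ, Integrable (fun ω => L α γ (shiftedPath σ R ω)) P := fun γ => by
    refine (integrable_matLift_flow (σ := fun t ω => shiftedPath σ R ω t) hA hC hτ α γ
      (measurable_const (a := t)) (T := t)
      (Filter.Eventually.of_forall fun _ => ⟨ht, le_rfl⟩)).congr ?_
    filter_upwards [hGτ] with ω hω
    rw [hω]
  have hZi : ∀ γ, Integrable (Z γ β) P := fun γ => by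
    refine (integrable_matLift_flow hA hC hσ γ β hR.measurable.coe_nnreal_real (T := T)
      (hT.mono fun ω hω => ⟨(R ω).coe_nonneg, hω⟩)).congr ?_
    filter_upwards [hZ] with ω hω
    exact (hω γ β).symm
  have hLZ : ∀ γ ∈ Finset.univ, Integrable (fun ω => L α γ (shiftedPath σ R ω) * Z γ β ω) P :=
    fun γ _ => (hindep γ).integrable_mul (hLi γ) (hZi γ)
  rw [integral_congr_ae hsplit, integral_finsetSum _ hLZ, Matrix.mul_apply]
  refine Finset.sum_congr rfl fun γ _ => ?_
  rw [← hLint, ← hZint]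
  exact (hindep γ).integral_mul_eq_mul_integral (hLi γ).aestronglyMeasurable
    (hZi γ).aestronglyMeasurable

end RandomFlow

/-! ### Schur stability -/

section Schur

open scoped Matrix.Norms.Operator

variable {ι : Type*} [Fintype ι] [DecidableEq ι] {B : Matrix ι ι ℝ}

theorem map_ofReal_pow (B : Matrix ι ι ℝ) (k : ℕ) :
    (B.map (fun r : ℝ => (r : ℂ))) ^ k = (B ^ k).map (fun r : ℝ => (r : ℂ)) :=
  (map_pow Complex.ofRealHom.mapMatrix B k).symm

theorem norm_entry_le_linfty_opNorm (M : Matrix ι ι ℂ) (i j : ι) : ‖M i j‖ ≤ ‖M‖ := by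
  rw [Matrix.linfty_opNorm_def, ← coe_nnnorm, NNReal.coe_le_coe]
  exact (Finset.single_le_sum (f := fun j => ‖M i j‖₊) (fun _ _ => zero_le)
      (Finset.mem_univ j)).trans
    (Finset.le_sup (f := fun i => ∑ j, ‖M i j‖₊) (Finset.mem_univ i))

/-- The powers of a Schur stable matrix decay geometrically, by Gelfand's formula. -/
theorem IsSchurStable.exists_abs_pow_le (h : IsSchurStable B) :
    ∃ r : ℝ, 0 < r ∧ r < 1 ∧ ∃ D : ℝ, 0 ≤ D ∧ ∀ k i j, |(B ^ k) i j| ≤ D * r ^ k := by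
  set M : Matrix ι ι ℂ := B.map (fun r : ℝ => (r : ℂ)) with hM
  obtain ⟨r, hr, hr1⟩ := ENNReal.lt_iff_exists_nnreal_btwn.1 h
  have hr1' : r < 1 := by exact_mod_cast hr1
  have hr0 : 0 < r := ENNReal.coe_pos.1 (zero_le.trans_lt hr)
  have hev : ∀ᶠ k : ℕ in Filter.atTop, ‖M ^ k‖ ≤ (r : ℝ) ^ k := by
    have ht := spectrum.pow_nnnorm_pow_one_div_tendsto_nhds_spectralRadius M
    filter_upwards [ht.eventually_lt_const hr, Filter.eventually_gt_atTop 0] with k hk hk0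
    have hk' : (0 : ℝ) < k := by exact_mod_cast hk0
    rw [one_div, ENNReal.rpow_inv_lt_iff hk', ENNReal.rpow_natCast] at hk
    have : ‖M ^ k‖₊ < r ^ k := by exact_mod_cast hk
    exact_mod_cast this.le
  obtain ⟨N, hN⟩ := Filter.eventually_atTop.1 hev
  have hr0' : (0 : ℝ) < r := hr0
  set f : ℕ → ℝ := fun k => ‖M ^ k‖ / (r : ℝ) ^ k with hf
  have hf0 : ∀ k, 0 ≤ f k := fun k => div_nonneg (norm_nonneg _) (pow_nonneg hr0'.le k)
  have hsum0 : 0 ≤ ∑ k ∈ Finset.range N, f k := Finset.sum_nonneg fun k _ => hf0 k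
  refine ⟨r, hr0', hr1', 1 + ∑ k ∈ Finset.range N, f k, by linarith, fun k i j => ?_⟩
  have h1 : |(B ^ k) i j| ≤ ‖M ^ k‖ := by
    have h2 := norm_entry_le_linfty_opNorm (M ^ k) i j
    rw [hM, map_ofReal_pow, Matrix.map_apply, Complex.norm_real] at h2
    rw [hM, map_ofReal_pow]
    exact h2
  refine h1.trans ?_
  have hrk : (0 : ℝ) < (r : ℝ) ^ k := by positivity
  rcases le_or_gt N k with hk | hk
  · refine (hN k hk).trans (le_mul_of_one_le_left hrk.le ?_)
    linarith
  · rw [← div_le_iff₀ hrk]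
    have h3 : f k ≤ ∑ k ∈ Finset.range N, f k :=
      Finset.single_le_sum (fun k _ => hf0 k) (Finset.mem_range.2 hk)
    exact h3.trans (by linarith)

theorem isSchurStable_of_tendsto
    (h : ∀ i j, Filter.Tendsto (fun k => (B ^ k) i j) Filter.atTop (nhds 0)) :
    IsSchurStable B := by
  set M : Matrix ι ι ℂ := B.map (fun r : ℝ => (r : ℂ)) with hM
  have hlim : Filter.Tendsto (fun k => M ^ k) Filter.atTop (nhds 0) := by
    refine tendsto_pi_nhds.2 fun i => tendsto_pi_nhds.2 fun j => ?_
    simp only [hM, map_ofReal_pow, Matrix.map_apply]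
    exact_mod_cast (Complex.continuous_ofReal.tendsto 0).comp (h i j)
  have hnorm : Filter.Tendsto (fun k => ‖M ^ k‖ * ‖(1 : Matrix ι ι ℂ)‖) Filter.atTop (nhds 0) := by
    simpa using hlim.norm.mul_const ‖(1 : Matrix ι ι ℂ)‖
  change spectralRadius ℂ M < 1
  rcases isEmpty_or_nonempty ι with hι | hι
  · simp [spectrum.SpectralRadius.of_subsingleton]
  refine spectrum.spectralRadius_lt_of_forall_lt M (r := 1) fun z hz => ?_
  by_contra hge
  obtain ⟨k, hk⟩ := (hnorm.eventually_lt_const zero_lt_one).exists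
  have h1 : ‖z ^ k‖ ≤ ‖M ^ k‖ * ‖(1 : Matrix ι ι ℂ)‖ :=
    spectrum.norm_le_norm_mul_of_mem (spectrum.pow_mem_pow M k hz)
  have h2 : 1 ≤ ‖z ^ k‖ := by
    rw [norm_pow]
    exact one_le_pow₀ (not_lt.1 hge)
  linarith

end Schur

/-! ### Covectors ordered by their values on the cone -/

/-- The order of covectors on the lifted space given by comparing the forms that they represent on
the cone `InCone m`. -/
def ConeLE {n m : ℕ} (v w : Exponent n m → ℝ) : Prop :=
  ∀ x : Fin n → ℝ, InCone m x → v ⬝ᵥ vecLift m x ≤ w ⬝ᵥ vecLift m x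

section Cone

variable {n m : ℕ} {B : Matrix (Exponent n m) (Exponent n m) ℝ}

theorem coneLE_pow (hB : ∀ v w : Exponent n m → ℝ, ConeLE v w → ConeLE (v ᵥ* B) (w ᵥ* B))
    {v w : Exponent n m → ℝ} (h : ConeLE v w) (k : ℕ) : ConeLE (v ᵥ* B ^ k) (w ᵥ* B ^ k) := by
  induction k with
  | zero => simpa using h
  | succ k ih =>
    rw [pow_succ, ← Matrix.vecMul_vecMul, ← Matrix.vecMul_vecMul]
    exact hB _ _ ih

theorem exists_coneLE_powerSum (hm : 0 < m) (v : Exponent n m → ℝ) :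
    ∃ c : ℝ, ConeLE v (c • powerSumCovector n m) := by
  refine ⟨∑ α, |v α| * weight α, fun x hx => ?_⟩
  rw [smul_dotProduct, smul_eq_mul]
  refine (le_abs_self _).trans ((abs_dotProduct_vecLift_le v x).trans ?_)
  refine mul_le_mul_of_nonneg_left (hx.norm_pow_le hm) ?_
  exact Finset.sum_nonneg fun α _ => mul_nonneg (abs_nonneg _) (weight_pos α).le

theorem coneLE_zero_powerSum (hm : 0 < m) : ConeLE 0 (powerSumCovector n m) := fun x hx => by
  rw [zero_dotProduct]
  exact (by positivity : 0 ≤ ‖x‖ ^ m).trans (hx.norm_pow_le hm)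

/-- A Lyapunov criterion: if `w ≥ 0` drops by at least `δ ∑ xᵢ^m` under the monotone map `B`, then
the forms `(∑ xᵢ^m) ∘ B^k` are summable on the cone, and they dominate all others. -/
theorem isSchurStable_of_coneLE (hm : 0 < m)
    (hB : ∀ v w : Exponent n m → ℝ, ConeLE v w → ConeLE (v ᵥ* B) (w ᵥ* B))
    {w : Exponent n m → ℝ} {δ : ℝ} (hδ : 0 < δ) (hw : ConeLE 0 w)
    (h : ConeLE (δ • powerSumCovector n m + w ᵥ* B) w) : IsSchurStable B := by
  set u := powerSumCovector n m with hu
  have hu0 : ∀ x : Fin n → ℝ, InCone m x →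
      Filter.Tendsto (fun k => (u ᵥ* B ^ k) ⬝ᵥ vecLift m x) Filter.atTop (nhds 0) := by
    intro x hx
    refine Summable.tendsto_atTop_zero ?_
    have hstep : ∀ k, δ * ((u ᵥ* B ^ k) ⬝ᵥ vecLift m x) + (w ᵥ* B ^ (k + 1)) ⬝ᵥ vecLift m x ≤
        (w ᵥ* B ^ k) ⬝ᵥ vecLift m x := fun k => by
      have := coneLE_pow hB h k x hx
      rwa [Matrix.add_vecMul, add_dotProduct, Matrix.smul_vecMul, smul_dotProduct,
        Matrix.vecMul_vecMul, ← pow_succ', smul_eq_mul] at this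
    have hsum : ∀ N, δ * ∑ k ∈ Finset.range N, (u ᵥ* B ^ k) ⬝ᵥ vecLift m x +
        (w ᵥ* B ^ N) ⬝ᵥ vecLift m x ≤ w ⬝ᵥ vecLift m x := by
      intro N
      induction N with
      | zero => simp
      | succ N ih =>
        rw [Finset.sum_range_succ, mul_add]
        linarith [hstep N]
    refine summable_of_sum_range_le (c := δ⁻¹ * (w ⬝ᵥ vecLift m x)) (fun k => ?_) fun N => ?_
    · simpa using coneLE_pow hB (coneLE_zero_powerSum hm) k x hx
    · have h1 := coneLE_pow hB hw N x hx
      rw [Matrix.zero_vecMul, zero_dotProduct] at h1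
      rw [← div_eq_inv_mul, le_div_iff₀ hδ]
      linarith [hsum N]
  have hv0 : ∀ (v : Exponent n m → ℝ) (x : Fin n → ℝ), InCone m x →
      Filter.Tendsto (fun k => (v ᵥ* B ^ k) ⬝ᵥ vecLift m x) Filter.atTop (nhds 0) := by
    intro v x hx
    obtain ⟨c, hc⟩ := exists_coneLE_powerSum hm v
    obtain ⟨d, hd⟩ := exists_coneLE_powerSum hm (-v)
    refine tendsto_of_tendsto_of_tendsto_of_le_of_le
      (g := fun k => -(d * ((u ᵥ* B ^ k) ⬝ᵥ vecLift m x)))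
      (h := fun k => c * ((u ᵥ* B ^ k) ⬝ᵥ vecLift m x))
      (by simpa using ((hu0 x hx).const_mul d).neg) (by simpa using (hu0 x hx).const_mul c)
      (fun k => ?_) fun k => ?_
    · have := coneLE_pow hB hd k x hx
      rw [Matrix.neg_vecMul, neg_dotProduct, Matrix.smul_vecMul, smul_dotProduct,
        smul_eq_mul] at this
      exact neg_le.1 this
    · have := coneLE_pow hB hc k x hx
      rwa [Matrix.smul_vecMul, smul_dotProduct, smul_eq_mul] at this
  have hall : ∀ v y : Exponent n m → ℝ,
      Filter.Tendsto (fun k => (v ᵥ* B ^ k) ⬝ᵥ y) Filter.atTop (nhds 0) := by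
    intro v y
    have hy : y ∈ Submodule.span ℝ (vecLift m '' {x : Fin n → ℝ | ∀ i, 0 ≤ x i}) := by
      rw [span_vecLift]; trivial
    induction hy using Submodule.span_induction with
    | mem y hy =>
      obtain ⟨x, hx, rfl⟩ := hy
      exact hv0 v x (Or.inr hx)
    | zero => simp
    | add y z _ _ hy hz => simpa using hy.add hz
    | smul c y _ hy => simpa using hy.const_mul c
  refine isSchurStable_of_tendsto fun α β => ?_
  simpa using hall (Pi.single α 1) (Pi.single β 1)

/-- Iterating `w ≤ c ∑ xᵢ^m + e (w ∘ B)` bounds `w` independently of its initial size when `e B`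
has geometrically decaying powers. -/
theorem exists_bound_of_coneLE
    (hB : ∀ v w : Exponent n m → ℝ, ConeLE v w → ConeLE (v ᵥ* B) (w ᵥ* B))
    {r D e : ℝ} (he : 0 ≤ e) (hr : 0 ≤ r) (her : e * r < 1)
    (hpow : ∀ k i j, |(B ^ k) i j| ≤ D * r ^ k) {c : ℝ} (hc : 0 ≤ c) :
    ∃ K : ℝ, ∀ w : Exponent n m → ℝ, ConeLE w (c • powerSumCovector n m + e • (w ᵥ* B)) →
      ∀ x : Fin n → ℝ, InCone m x → w ⬝ᵥ vecLift m x ≤ K * ‖x‖ ^ m := by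
  set u := powerSumCovector n m with hu
  -- The size of `v ∘ B^k` as a form, up to the factor `r^k`.
  set s : (Exponent n m → ℝ) → ℝ := fun v => ∑ β : Exponent n m, (∑ α, |v α| * D) * weight β
    with hs
  have hbd : ∀ (v : Exponent n m → ℝ) (k : ℕ) (x : Fin n → ℝ),
      (v ᵥ* B ^ k) ⬝ᵥ vecLift m x ≤ s v * r ^ k * ‖x‖ ^ m := by
    intro v k x
    refine (le_abs_self _).trans ((abs_dotProduct_vecLift_le _ x).trans ?_)
    refine mul_le_mul_of_nonneg_right ?_ (by positivity)
    rw [hs, Finset.sum_mul]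
    refine Finset.sum_le_sum fun β _ => ?_
    rw [mul_right_comm]
    refine mul_le_mul_of_nonneg_right ?_ (weight_pos β).le
    rw [Finset.sum_mul]
    refine (Finset.abs_sum_le_sum_abs (fun α => v α * (B ^ k) α β) _).trans ?_
    refine Finset.sum_le_sum fun α _ => ?_
    rw [abs_mul, mul_assoc]
    exact mul_le_mul_of_nonneg_left (hpow k α β) (abs_nonneg _)
  refine ⟨c * s u * (1 - e * r)⁻¹, fun w hw x hx => ?_⟩
  have hiter : ∀ N : ℕ, w ⬝ᵥ vecLift m x ≤
      c * ∑ k ∈ Finset.range N, e ^ k * ((u ᵥ* B ^ k) ⬝ᵥ vecLift m x) +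
        e ^ N * ((w ᵥ* B ^ N) ⬝ᵥ vecLift m x) := by
    intro N
    induction N with
    | zero => simp
    | succ N ih =>
      have h1 := coneLE_pow hB hw N x hx
      rw [Matrix.add_vecMul, add_dotProduct, Matrix.smul_vecMul, smul_dotProduct,
        Matrix.smul_vecMul, smul_dotProduct, Matrix.vecMul_vecMul, ← pow_succ', smul_eq_mul,
        smul_eq_mul] at h1
      have h2 := mul_le_mul_of_nonneg_left h1 (pow_nonneg he N)
      rw [Finset.sum_range_succ, mul_add, pow_succ]
      nlinarith [ih, h2]
  have her0 : 0 ≤ e * r := mul_nonneg he hr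
  have hsu : 0 ≤ s u := by
    refine Finset.sum_nonneg fun β _ => mul_nonneg (Finset.sum_nonneg fun α _ => ?_)
      (weight_pos β).le
    refine mul_nonneg (abs_nonneg _) ?_
    simpa using (abs_nonneg _).trans (hpow 0 α β)
  have hle : ∀ N : ℕ, w ⬝ᵥ vecLift m x ≤
      c * s u * (1 - e * r)⁻¹ * ‖x‖ ^ m + s w * ‖x‖ ^ m * (e * r) ^ N := by
    intro N
    refine (hiter N).trans (add_le_add ?_ ?_)
    · have h1 : ∑ k ∈ Finset.range N, e ^ k * ((u ᵥ* B ^ k) ⬝ᵥ vecLift m x) ≤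
          ∑ k ∈ Finset.range N, s u * ‖x‖ ^ m * (e * r) ^ k := by
        refine Finset.sum_le_sum fun k _ => ?_
        refine (mul_le_mul_of_nonneg_left (hbd u k x) (pow_nonneg he k)).trans (le_of_eq ?_)
        rw [mul_pow]; ring
      have h2 : ∑ k ∈ Finset.range N, (e * r) ^ k ≤ (1 - e * r)⁻¹ := by
        rw [← tsum_geometric_of_lt_one her0 her]
        exact (summable_geometric_of_lt_one her0 her).sum_le_tsum _ fun k _ => pow_nonneg her0 k
      rw [← Finset.mul_sum] at h1
      calc _ ≤ c * (s u * ‖x‖ ^ m * ∑ k ∈ Finset.range N, (e * r) ^ k) :=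
            mul_le_mul_of_nonneg_left h1 hc
        _ ≤ c * (s u * ‖x‖ ^ m * (1 - e * r)⁻¹) := by gcongr
        _ = _ := by ring
    · refine (mul_le_mul_of_nonneg_left (hbd w N x) (pow_nonneg he N)).trans (le_of_eq ?_)
      rw [mul_pow]; ring
  refine ge_of_tendsto' (f := fun N : ℕ =>
    c * s u * (1 - e * r)⁻¹ * ‖x‖ ^ m + s w * ‖x‖ ^ m * (e * r) ^ N) (x := Filter.atTop) ?_ hle
  simpa using ((tendsto_pow_atTop_nhds_zero_of_lt_one her0 her).const_mul
    (s w * ‖x‖ ^ m)).const_add (c * s u * (1 - e * r)⁻¹ * ‖x‖ ^ m)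

end Cone

/-! ### Short-time bounds for the flow -/

/-- For a short time, the flow of any coefficient with the given bound at most halves the norm. -/
theorem exists_norm_le_two_mul_norm_flow (n : ℕ) (C : ℝ) :
    ∃ ε : ℝ, 0 < ε ∧ ∀ a : ℝ → Matrix (Fin n) (Fin n) ℝ, (∀ s i j, |a s i j| ≤ C) →
      ∀ t, 0 ≤ t → t ≤ ε → ∀ x : Fin n → ℝ, ‖x‖ ≤ 2 * ‖flow a t *ᵥ x‖ := by
  have hcont : Continuous fun t : ℝ => n * (Real.exp (n * |C| * t) - 1) := by fun_prop
  have hlim : Filter.Tendsto (fun t : ℝ => n * (Real.exp (n * |C| * t) - 1)) (nhds 0)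
      (nhds 0) := by simpa using hcont.tendsto 0
  obtain ⟨ε, hε, hball⟩ := Metric.eventually_nhds_iff.1
    (hlim.eventually_lt_const (by norm_num : (0 : ℝ) < 1 / 2))
  refine ⟨ε / 2, by positivity, fun a ha t ht htε x => ?_⟩
  have ha' : ∀ s i j, |a s i j| ≤ |C| := fun s i j => (ha s i j).trans (le_abs_self C)
  have hsmall := hball (y := t) (by rw [Real.dist_0_eq_abs, abs_of_nonneg ht]; linarith)
  have hexp : 0 ≤ Real.exp (n * |C| * t) - 1 := sub_nonneg.2 (Real.one_le_exp (by positivity))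
  have h1 : ‖(flow a t - 1) *ᵥ x‖ ≤ n * (Real.exp (n * |C| * t) - 1) * ‖x‖ :=
    norm_mulVec_le hexp (fun i j => abs_flow_sub_one_le ha' ht i j) x
  have h2 : ‖x‖ ≤ ‖flow a t *ᵥ x‖ + ‖(flow a t - 1) *ᵥ x‖ := by
    have := norm_sub_le (flow a t *ᵥ x) ((flow a t - 1) *ᵥ x)
    rw [Matrix.sub_mulVec, Matrix.one_mulVec] at this ⊢
    rwa [sub_sub_cancel] at this
  nlinarith [norm_nonneg x]

/-! ### Renewal decomposition of moments -/

theorem setLIntegral_Ioi_eq_add (g : ℝ → ℝ≥0∞) {r : ℝ} (hr : 0 ≤ r) :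
    ∫⁻ t in Set.Ioi 0, g t = (∫⁻ t in Set.Ioc 0 r, g t) + ∫⁻ t in Set.Ioi 0, g (t + r) := by
  rw [← Set.Ioc_union_Ioi_eq_Ioi hr, lintegral_union measurableSet_Ioi
    (Set.Ioc_disjoint_Ioi le_rfl)]
  congr 1
  rw [Set.Ioc_union_Ioi_eq_Ioi hr, ← lintegral_indicator measurableSet_Ioi,
    ← lintegral_indicator measurableSet_Ioi, ← lintegral_add_right_eq_self _ r]
  refine lintegral_congr fun t => ?_
  simp [Set.indicator_apply]

/-- Splitting a moment integral at a random time. -/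
theorem lintegral_split_at_random_time {Ω : Type*} [MeasurableSpace Ω] {P : Measure Ω} [SFinite P]
    {R : Ω → ℝ≥0} (hR : Measurable R) {g : ℝ × Ω → ℝ≥0∞} (hg : Measurable g) :
    ∫⁻ t in Set.Ioi 0, ∫⁻ ω, g (t, ω) ∂P =
      (∫⁻ ω, (∫⁻ t in Set.Ioc 0 (R ω : ℝ), g (t, ω)) ∂P) +
        ∫⁻ t in Set.Ioi 0, ∫⁻ ω, g (t + R ω, ω) ∂P := by
  have hg' : Measurable fun p : ℝ × Ω => g (p.1 + R p.2, p.2) := hg.comp (by fun_prop)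
  rw [lintegral_lintegral_swap (f := fun t ω => g (t, ω)) hg.aemeasurable,
    lintegral_lintegral_swap (f := fun t ω => g (t + R ω, ω)) hg'.aemeasurable,
    ← lintegral_add_right _ hg'.lintegral_prod_left']
  exact lintegral_congr fun ω => setLIntegral_Ioi_eq_add (fun t => g (t, ω)) (R ω).coe_nonneg

/-- A switched linear system with matrices bounded by `C`, driven by a measurable process with a
regeneration epoch bounded by `T`. -/
structure IsBoundedRegenerative {Ω S : Type*} [MeasurableSpace Ω] [MeasurableSpace S]
    (P : Measure Ω) {n : ℕ} (A : S → Matrix (Fin n) (Fin n) ℝ) (C : ℝ) (σ : ℝ≥0 → Ω → S)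
    (R : Ω → ℝ≥0) (T : ℝ≥0) : Prop where
  measurable_matrix : ∀ i j, Measurable fun s => A s i j
  bound : ∀ s i j, |A s i j| ≤ C
  measurable_process : Measurable fun p : ℝ≥0 × Ω => σ p.1 p.2
  epoch : IsRegenerationEpoch P σ R
  epoch_le : ∀ᵐ ω ∂P, R ω ≤ T

/-- Almost surely, trajectories that start in the cone `InCone m` stay there. -/
def PreservesCone {Ω S : Type*} [MeasurableSpace Ω] (P : Measure Ω) {n : ℕ}
    (A : S → Matrix (Fin n) (Fin n) ℝ) (σ : ℝ≥0 → Ω → S) (m : ℕ) : Prop :=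
  ∀ x : Fin n → ℝ, InCone m x → ∀ᵐ ω ∂P, ∀ t, 0 ≤ t →
    InCone m (flow (coefficient A σ ω) t *ᵥ x)

/-- The matrix `∫₀^∞ ρ(t) E[Φ(t)^[m]] dt`. -/
noncomputable def weightedLift {Ω S : Type*} [MeasurableSpace Ω] (P : Measure Ω) {n : ℕ}
    (A : S → Matrix (Fin n) (Fin n) ℝ) (σ : ℝ≥0 → Ω → S) (m : ℕ) (ρ : ℝ → ℝ) :
    Matrix (Exponent n m) (Exponent n m) ℝ :=
  fun α β => ∫ t in Set.Ioi 0, ρ t * meanLift P A σ m t α β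

theorem setIntegral_vecMul_meanLift {Ω S : Type*} [MeasurableSpace Ω] {P : Measure Ω} {n m : ℕ}
    {A : S → Matrix (Fin n) (Fin n) ℝ} {σ : ℝ≥0 → Ω → S} {ρ : ℝ → ℝ}
    (hint : ∀ α β : Exponent n m,
      IntegrableOn (fun t => ρ t * meanLift P A σ m t α β) (Set.Ioi 0))
    (v y : Exponent n m → ℝ) :
    IntegrableOn (fun t => ρ t * ((v ᵥ* meanLift P A σ m t) ⬝ᵥ y)) (Set.Ioi 0) ∧
      ∫ t in Set.Ioi 0, ρ t * ((v ᵥ* meanLift P A σ m t) ⬝ᵥ y) =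
        (v ᵥ* weightedLift P A σ m ρ) ⬝ᵥ y := by
  have hexp : ∀ t, ρ t * ((v ᵥ* meanLift P A σ m t) ⬝ᵥ y) =
      ∑ β, ∑ α, v α * y β * (ρ t * meanLift P A σ m t α β) := fun t => by
    simp only [dotProduct, Matrix.vecMul, Finset.mul_sum, Finset.sum_mul]
    exact Finset.sum_congr rfl fun β _ => Finset.sum_congr rfl fun α _ => by ring
  have hi : ∀ β α : Exponent n m, Integrable
      (fun t => v α * y β * (ρ t * meanLift P A σ m t α β)) (volume.restrict (Set.Ioi 0)) :=
    fun β α => (hint α β).const_mul _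
  simp only [hexp]
  refine ⟨integrable_finsetSum _ fun β _ => integrable_finsetSum _ fun α _ => hi β α, ?_⟩
  rw [integral_finsetSum _ fun β _ => integrable_finsetSum _ fun α _ => hi β α]
  simp only [dotProduct, Matrix.vecMul, Finset.sum_mul]
  refine Finset.sum_congr rfl fun β _ => ?_
  rw [integral_finsetSum _ fun α _ => hi β α]
  refine Finset.sum_congr rfl fun α _ => ?_
  rw [integral_const_mul, weightedLift]
  ring

section Moments

variable {Ω S : Type*} [MeasurableSpace Ω] [MeasurableSpace S] {P : Measure Ω}
  {n m : ℕ} {A : S → Matrix (Fin n) (Fin n) ℝ} {C : ℝ}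
  {σ : ℝ≥0 → Ω → S} {R : Ω → ℝ≥0} {T : ℝ≥0}

/-- By continuity of trajectories, the exceptional null set can be chosen independently of time. -/
theorem IsBoundedRegenerative.preservesCone (h : IsBoundedRegenerative P A C σ R T)
    (hmA : Even m ∨ IsPositiveSystem P A σ) : PreservesCone P A σ m := by
  intro x hx
  by_cases hm : Even m
  · exact Filter.Eventually.of_forall fun ω t _ => Or.inl hm
  have hpos := hmA.resolve_left hm x (hx.resolve_left hm)
  have hq : ∀ᵐ ω ∂P, ∀ q : ℚ, InCone m (flow (coefficient A σ ω) (max (q : ℝ) 0) *ᵥ x) := by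
    refine ae_all_iff.2 fun q => (hpos (max (q : ℝ) 0) (le_max_right _ _)).mono fun ω hω => ?_
    rw [state_eq h.measurable_matrix h.bound h.measurable_process x (le_max_right _ _)] at hω
    exact Or.inr hω
  filter_upwards [hq] with ω hω t ht
  have hcont : Continuous fun s : ℝ => flow (coefficient A σ ω) (max s 0) *ᵥ x := by
    have h1 := continuousOn_flow
      (measurable_coefficient_path h.measurable_matrix h.measurable_process ω)
      (fun _ => h.bound _)
    have h2 : Continuous fun s : ℝ => flow (coefficient A σ ω) (max s 0) :=
      h1.comp_continuous (by fun_prop) fun s => le_max_right s 0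
    exact Continuous.matrix_mulVec h2 continuous_const
  have := Rat.denseRange_cast.induction_on
    (p := fun s : ℝ => InCone m (flow (coefficient A σ ω) (max s 0) *ᵥ x)) t
    ((isClosed_inCone n m).preimage hcont) hω
  rwa [max_eq_left ht] at this

theorem integrable_dotProduct_vecLift {M : Ω → Matrix (Fin n) (Fin n) ℝ}
    (hM : ∀ α β, Integrable (fun ω => matLift m (M ω) α β) P) (v : Exponent n m → ℝ)
    (x : Fin n → ℝ) : Integrable (fun ω => v ⬝ᵥ vecLift m (M ω *ᵥ x)) P := by
  simp only [← matLift_mulVec_vecLift, dotProduct, Matrix.mulVec]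
  exact integrable_finsetSum _ fun α _ => (integrable_finsetSum _ fun β _ =>
    (hM α β).mul_const _).const_mul _

theorem integral_dotProduct_vecLift {M : Ω → Matrix (Fin n) (Fin n) ℝ}
    (hM : ∀ α β, Integrable (fun ω => matLift m (M ω) α β) P) (v : Exponent n m → ℝ)
    (x : Fin n → ℝ) : ∫ ω, v ⬝ᵥ vecLift m (M ω *ᵥ x) ∂P =
      (v ᵥ* Matrix.of fun α β => ∫ ω, matLift m (M ω) α β ∂P) ⬝ᵥ vecLift m x := by
  rw [← Matrix.dotProduct_mulVec]
  simp only [← matLift_mulVec_vecLift, dotProduct, Matrix.mulVec, Matrix.of_apply]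
  rw [integral_finsetSum _ fun α _ => (integrable_finsetSum _ fun β _ =>
    (hM α β).mul_const _).const_mul _]
  refine Finset.sum_congr rfl fun α _ => ?_
  rw [integral_const_mul, integral_finsetSum _ fun β _ => (hM α β).mul_const _]
  simp only [integral_mul_const]

theorem IsBoundedRegenerative.measurable_flow_mulVec (h : IsBoundedRegenerative P A C σ R T)
    (x : Fin n → ℝ) : Measurable fun p : ℝ × Ω => flow (coefficient A σ p.2) p.1 *ᵥ x := by
  refine measurable_pi_lambda _ fun i => ?_
  simp only [Matrix.mulVec, dotProduct]
  exact Finset.measurable_sum _ fun j _ => (measurable_randomFlow h.measurable_matrix h.bound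
    h.measurable_process i j).mul_const _

theorem lintegral_powerSum {M : Ω → Matrix (Fin n) (Fin n) ℝ} (hm : 0 < m)
    (hM : ∀ α β, Integrable (fun ω => matLift m (M ω) α β) P) {x : Fin n → ℝ}
    (hx : ∀ᵐ ω ∂P, InCone m (M ω *ᵥ x)) :
    ∫⁻ ω, ENNReal.ofReal (powerSumCovector n m ⬝ᵥ vecLift m (M ω *ᵥ x)) ∂P = ENNReal.ofReal
      ((powerSumCovector n m ᵥ* Matrix.of fun α β => ∫ ω, matLift m (M ω) α β ∂P) ⬝ᵥ
        vecLift m x) ∧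
    0 ≤ (powerSumCovector n m ᵥ* Matrix.of fun α β => ∫ ω, matLift m (M ω) α β ∂P) ⬝ᵥ
        vecLift m x := by
  have h0 : ∀ᵐ ω ∂P, 0 ≤ powerSumCovector n m ⬝ᵥ vecLift m (M ω *ᵥ x) := hx.mono fun ω hω => by
    simpa using coneLE_zero_powerSum hm _ hω
  rw [← integral_dotProduct_vecLift hM]
  exact ⟨(ofReal_integral_eq_lintegral_ofReal (integrable_dotProduct_vecLift hM _ x) h0).symm,
    integral_nonneg_of_ae h0⟩

variable [IsProbabilityMeasure P]

namespace IsBoundedRegenerative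

theorem integrable_matLift (h : IsBoundedRegenerative P A C σ R T) (α β : Exponent n m) {t : ℝ}
    (ht : 0 ≤ t) : Integrable (fun ω => matLift m (flow (coefficient A σ ω) t) α β) P :=
  integrable_matLift_flow h.measurable_matrix h.bound h.measurable_process α β
    (measurable_const (a := t)) (T := t) (Filter.Eventually.of_forall fun _ => ⟨ht, le_rfl⟩)

theorem integrable_matLift_add_epoch (h : IsBoundedRegenerative P A C σ R T) (α β : Exponent n m)
    {t : ℝ} (ht : 0 ≤ t) :
    Integrable (fun ω => matLift m (flow (coefficient A σ ω) (t + R ω)) α β) P := by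
  refine integrable_matLift_flow h.measurable_matrix h.bound h.measurable_process α β
    (measurable_const.add h.epoch.measurable.coe_nnreal_real) (T := t + T) ?_
  filter_upwards [h.epoch_le] with ω hω
  exact ⟨by positivity, by gcongr⟩

theorem integrable_matLift_epoch (h : IsBoundedRegenerative P A C σ R T) (α β : Exponent n m) :
    Integrable (fun ω => matLift m (flow (coefficient A σ ω) (R ω)) α β) P := by
  simpa using h.integrable_matLift_add_epoch α β le_rfl

/-- The expected lift over a cycle preserves the order of forms on the invariant cone. -/
theorem coneLE_vecMul (h : IsBoundedRegenerative P A C σ R T) (hcone : PreservesCone P A σ m)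
    {v w : Exponent n m → ℝ} (hvw : ConeLE v w) :
    ConeLE (v ᵥ* expectedLift P A σ R m) (w ᵥ* expectedLift P A σ R m) := by
  intro x hx
  have hB : expectedLift P A σ R m =
      Matrix.of fun α β => ∫ ω, matLift m (flow (coefficient A σ ω) (R ω)) α β ∂P := by
    ext α β
    simp only [expectedLift, Matrix.of_apply,
      firstCycleMatrix_eq h.measurable_matrix h.bound h.measurable_process]
  rw [hB, ← integral_dotProduct_vecLift h.integrable_matLift_epoch,
    ← integral_dotProduct_vecLift h.integrable_matLift_epoch]
  refine integral_mono_ae (integrable_dotProduct_vecLift h.integrable_matLift_epoch _ _)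
    (integrable_dotProduct_vecLift h.integrable_matLift_epoch _ _) ?_
  filter_upwards [hcone x hx] with ω hω
  exact hvw _ (hω _ (R ω).coe_nonneg)

theorem measurable_meanLift (h : IsBoundedRegenerative P A C σ R T) (α β : Exponent n m) :
    Measurable fun t => meanLift P A σ m t α β :=
  (measurable_matLift_flow h.measurable_matrix h.bound h.measurable_process
    α β).stronglyMeasurable.integral_prod_right'.measurable

theorem lintegral_weight_powerSum (h : IsBoundedRegenerative P A C σ R T) (hm : 0 < m)
    (hcone : PreservesCone P A σ m) {ρ : ℝ → ℝ} (hρ : ∀ t, 0 ≤ ρ t)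
    (hint : ∀ α β : Exponent n m,
      IntegrableOn (fun t => ρ t * meanLift P A σ m t α β) (Set.Ioi 0))
    {x : Fin n → ℝ} (hx : InCone m x) :
    ∫⁻ t in Set.Ioi 0, ∫⁻ ω, ENNReal.ofReal (ρ t) * ENNReal.ofReal
        (powerSumCovector n m ⬝ᵥ vecLift m (flow (coefficient A σ ω) t *ᵥ x)) ∂P =
      ENNReal.ofReal ((powerSumCovector n m ᵥ* weightedLift P A σ m ρ) ⬝ᵥ vecLift m x) := by
  obtain ⟨h1, h2⟩ := setIntegral_vecMul_meanLift hint (powerSumCovector n m) (vecLift m x)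
  have h3 := fun (t : ℝ) (ht : 0 < t) =>
    lintegral_powerSum (M := fun ω => flow (coefficient A σ ω) t) hm
      (fun α β => h.integrable_matLift α β ht.le) ((hcone x hx).mono fun ω hω => hω t ht.le)
  rw [← h2, ofReal_integral_eq_lintegral_ofReal h1]
  · refine setLIntegral_congr_fun measurableSet_Ioi fun t ht => ?_
    rw [lintegral_const_mul' _ _ ENNReal.ofReal_ne_top, (h3 t ht).1,
      ENNReal.ofReal_mul (hρ t)]
    rfl
  · filter_upwards [ae_restrict_mem measurableSet_Ioi] with t ht
    exact mul_nonneg (hρ t) (h3 t ht).2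

theorem lintegral_weight_powerSum_add_epoch (h : IsBoundedRegenerative P A C σ R T) (hm : 0 < m)
    (hcone : PreservesCone P A σ m) {ρ : ℝ → ℝ} (hρ : ∀ t, 0 ≤ ρ t)
    (hint : ∀ α β : Exponent n m,
      IntegrableOn (fun t => ρ t * meanLift P A σ m t α β) (Set.Ioi 0))
    {x : Fin n → ℝ} (hx : InCone m x) :
    ∫⁻ t in Set.Ioi 0, ∫⁻ ω, ENNReal.ofReal (ρ t) * ENNReal.ofReal
        (powerSumCovector n m ⬝ᵥ vecLift m (flow (coefficient A σ ω) (t + R ω) *ᵥ x)) ∂P =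
      ENNReal.ofReal ((powerSumCovector n m ᵥ* weightedLift P A σ m ρ ᵥ*
        expectedLift P A σ R m) ⬝ᵥ vecLift m x) := by
  obtain ⟨h1, h2⟩ := setIntegral_vecMul_meanLift hint (powerSumCovector n m)
    (expectedLift P A σ R m *ᵥ vecLift m x)
  have h3 := fun (t : ℝ) (ht : 0 < t) =>
    lintegral_powerSum (M := fun ω => flow (coefficient A σ ω) (t + R ω)) hm
      (fun α β => h.integrable_matLift_add_epoch α β ht.le)
      ((hcone x hx).mono fun ω hω => hω _ (by positivity))
  have h4 : ∀ t, 0 < t →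
      (Matrix.of fun α β => ∫ ω, matLift m (flow (coefficient A σ ω) (t + R ω)) α β ∂P) =
        meanLift P A σ m t * expectedLift P A σ R m := fun t ht => by
    ext α β
    exact integral_matLift_flow_add_epoch h.measurable_matrix h.bound h.measurable_process
      h.epoch h.epoch_le ht.le α β
  rw [← Matrix.dotProduct_mulVec, ← h2, ofReal_integral_eq_lintegral_ofReal h1]
  · refine setLIntegral_congr_fun measurableSet_Ioi fun t ht => ?_
    rw [lintegral_const_mul' _ _ ENNReal.ofReal_ne_top, (h3 t ht).1, h4 t ht,
      ENNReal.ofReal_mul (hρ t), ← Matrix.vecMul_vecMul, Matrix.dotProduct_mulVec]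
  · filter_upwards [ae_restrict_mem measurableSet_Ioi] with t ht
    have h5 := (h3 t ht).2
    rw [h4 t ht, ← Matrix.vecMul_vecMul, ← Matrix.dotProduct_mulVec] at h5
    exact mul_nonneg (hρ t) h5

/-- The renewal equation for the weighted moments of `∑ xᵢ^m`. -/
theorem weightedLift_renewal (h : IsBoundedRegenerative P A C σ R T) (hm : 0 < m)
    (hcone : PreservesCone P A σ m) {ρ : ℝ → ℝ} (hρm : Measurable ρ) (hρ : ∀ t, 0 ≤ ρ t)
    (hint : ∀ α β : Exponent n m,
      IntegrableOn (fun t => ρ t * meanLift P A σ m t α β) (Set.Ioi 0))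
    {x : Fin n → ℝ} (hx : InCone m x) :
    ENNReal.ofReal ((powerSumCovector n m ᵥ* weightedLift P A σ m ρ) ⬝ᵥ vecLift m x) =
      (∫⁻ ω, (∫⁻ t in Set.Ioc 0 (R ω : ℝ), ENNReal.ofReal (ρ t) * ENNReal.ofReal
        (powerSumCovector n m ⬝ᵥ vecLift m (flow (coefficient A σ ω) t *ᵥ x))) ∂P) +
      ∫⁻ t in Set.Ioi 0, ∫⁻ ω, ENNReal.ofReal (ρ (t + R ω)) * ENNReal.ofReal
        (powerSumCovector n m ⬝ᵥ vecLift m (flow (coefficient A σ ω) (t + R ω) *ᵥ x)) ∂P := by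
  rw [← h.lintegral_weight_powerSum hm hcone hρ hint hx]
  refine lintegral_split_at_random_time h.epoch.measurable (g := fun p : ℝ × Ω =>
    ENNReal.ofReal (ρ p.1) * ENNReal.ofReal
      (powerSumCovector n m ⬝ᵥ vecLift m (flow (coefficient A σ p.2) p.1 *ᵥ x))) ?_
  have h1 : Measurable fun y : Fin n → ℝ => powerSumCovector n m ⬝ᵥ vecLift m y :=
    (continuous_const.dotProduct (continuous_vecLift m)).measurable
  exact (hρm.comp measurable_fst).ennreal_ofReal.mul
    (h1.comp (h.measurable_flow_mulVec x)).ennreal_ofReal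

theorem coneLE_zero_weightedLift (h : IsBoundedRegenerative P A C σ R T) (hm : 0 < m)
    (hcone : PreservesCone P A σ m) {ρ : ℝ → ℝ} (hρ : ∀ t, 0 ≤ ρ t)
    (hint : ∀ α β : Exponent n m,
      IntegrableOn (fun t => ρ t * meanLift P A σ m t α β) (Set.Ioi 0)) :
    ConeLE 0 (powerSumCovector n m ᵥ* weightedLift P A σ m ρ) := by
  intro x hx
  rw [zero_dotProduct, ← (setIntegral_vecMul_meanLift hint _ _).2]
  refine setIntegral_nonneg measurableSet_Ioi fun t (ht : 0 < t) => mul_nonneg (hρ t) ?_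
  exact (lintegral_powerSum (M := fun ω => flow (coefficient A σ ω) t) hm
    (fun α β => h.integrable_matLift α β ht.le) ((hcone x hx).mono fun ω hω => hω t ht.le)).2

end IsBoundedRegenerative

end Moments

/-! ### Stochastic mean stability implies Schur stability -/

theorem lintegral_sum_const_mul {X ι : Type*} [MeasurableSpace X] {μ : Measure X} [Fintype ι]
    (c : ι → ℝ≥0∞) (f : ι → X → ℝ≥0∞) (hf : ∀ j, Measurable (f j)) :
    ∫⁻ x, ∑ j, c j * f j x ∂μ = ∑ j, c j * ∫⁻ x, f j x ∂μ := by
  rw [lintegral_finsetSum _ fun j _ => (hf j).const_mul _]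
  exact Finset.sum_congr rfl fun j _ => lintegral_const_mul _ (hf j)

section Stability

variable {Ω S : Type*} [MeasurableSpace Ω] [MeasurableSpace S] {P : Measure Ω}
  [IsProbabilityMeasure P] {n m : ℕ} {A : S → Matrix (Fin n) (Fin n) ℝ} {C : ℝ}
  {σ : ℝ≥0 → Ω → S} {R : Ω → ℝ≥0} {T : ℝ≥0}

namespace IsBoundedRegenerative

theorem integrableOn_meanLift (h : IsBoundedRegenerative P A C σ R T)
    (hst : IsStochMeanStable P A σ m) (α β : Exponent n m) :
    IntegrableOn (fun t => meanLift P A σ m t α β) (Set.Ioi 0) := by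
  obtain ⟨N, c, x, hc, hle⟩ := exists_abs_matLift_le α β
  refine ⟨(h.measurable_meanLift α β).aestronglyMeasurable, ?_⟩
  set q : Fin N → ℝ → Ω → ℝ≥0∞ := fun j t ω =>
    ENNReal.ofReal (‖flow (coefficient A σ ω) t *ᵥ x j‖ ^ m) with hq
  have hmeas : ∀ j, Measurable fun p : ℝ × Ω => q j p.1 p.2 := fun j =>
    ((h.measurable_flow_mulVec (x j)).norm.pow_const m).ennreal_ofReal
  have hfin : ∀ j, ∫⁻ t in Set.Ioi 0, ∫⁻ ω, q j t ω ∂P < ∞ := fun j => by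
    refine lt_of_le_of_lt (setLIntegral_mono' measurableSet_Ioi fun t (ht : 0 < t) => ?_)
      (hst (x j))
    refine lintegral_mono fun ω => ENNReal.ofReal_le_ofReal ?_
    rw [state_eq h.measurable_matrix h.bound h.measurable_process _ ht.le]
    exact pow_le_pow_left₀ (norm_nonneg _) (norm_le_norm_toLp _) m
  have hbd : ∀ t, ‖meanLift P A σ m t α β‖ₑ ≤
      ∑ j, ENNReal.ofReal (c j) * ∫⁻ ω, q j t ω ∂P := fun t => by
    have hmt : ∀ j, Measurable (q j t) := fun j =>
      (hmeas j).comp (f := fun ω => (t, ω)) measurable_prodMk_left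
    rw [← lintegral_sum_const_mul _ _ hmt]
    refine (enorm_integral_le_lintegral_enorm _).trans (lintegral_mono fun ω => ?_)
    rw [Real.enorm_eq_ofReal_abs]
    have h0 : ∀ j ∈ Finset.univ, 0 ≤ c j * ‖flow (coefficient A σ ω) t *ᵥ x j‖ ^ m :=
      fun j _ => mul_nonneg (hc j) (pow_nonneg (norm_nonneg _) m)
    refine (ENNReal.ofReal_le_ofReal (hle _)).trans (le_of_eq ?_)
    rw [ENNReal.ofReal_sum_of_nonneg h0]
    exact Finset.sum_congr rfl fun j _ => ENNReal.ofReal_mul (hc j)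
  refine lt_of_le_of_lt (lintegral_mono hbd) ?_
  rw [lintegral_sum_const_mul _ _ fun j => (hmeas j).lintegral_prod_right']
  exact ENNReal.sum_lt_top.2 fun j _ => ENNReal.mul_lt_top ENNReal.ofReal_lt_top (hfin j)

theorem isSchurStable (h : IsBoundedRegenerative P A C σ R T) (hm : 0 < m)
    (hcone : PreservesCone P A σ m) (hst : IsStochMeanStable P A σ m) :
    IsSchurStable (expectedLift P A σ R m) := by
  set u := powerSumCovector n m with hu
  have hint : ∀ α β : Exponent n m,
      IntegrableOn (fun t => (1 : ℝ) * meanLift P A σ m t α β) (Set.Ioi 0) := fun α β => by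
    simpa using h.integrableOn_meanLift hst α β
  set w := u ᵥ* weightedLift P A σ m (fun _ => 1) with hwdef
  have hw0 : ConeLE 0 w := h.coneLE_zero_weightedLift hm hcone (fun _ => zero_le_one) hint
  obtain ⟨ε, hε, hhalf⟩ := exists_norm_le_two_mul_norm_flow n C
  -- The expected length of the part of the first cycle on which the state is at least halved.
  set ℓ : ℝ := ∫ ω, min (R ω : ℝ) ε ∂P with hℓdef
  have hmin0 : ∀ ω, 0 ≤ min (R ω : ℝ) ε := fun ω => le_min (R ω).coe_nonneg hε.le
  have hℓint : Integrable (fun ω => min (R ω : ℝ) ε) P := by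
    refine Integrable.of_bound (h.epoch.measurable.coe_nnreal_real.min
      measurable_const).aestronglyMeasurable ε (Filter.Eventually.of_forall fun ω => ?_)
    rw [Real.norm_eq_abs, abs_of_nonneg (hmin0 ω)]
    exact min_le_right _ _
  have hℓ : 0 < ℓ := by
    refine (integral_pos_iff_support_of_nonneg hmin0 hℓint).2 ?_
    have hsupp : Function.support (fun ω => min (R ω : ℝ) ε) =ᵐ[P] Set.univ := by
      refine Filter.eventuallyEq_univ.2 ?_
      filter_upwards [h.epoch.pos] with ω hω
      exact (lt_min (NNReal.coe_pos.2 hω) hε).ne'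
    rw [measure_congr hsupp, measure_univ]
    exact zero_lt_one
  set κ : ℝ := ((2 : ℝ) ^ m * (n + 1))⁻¹ with hκdef
  have hκ : 0 < κ := by positivity
  refine isSchurStable_of_coneLE hm (fun v w => h.coneLE_vecMul hcone) (w := w) (δ := κ * ℓ)
    (by positivity) hw0 fun x hx => ?_
  have hux : 0 ≤ u ⬝ᵥ vecLift m x := by simpa using coneLE_zero_powerSum hm x hx
  have hwB : 0 ≤ (w ᵥ* expectedLift P A σ R m) ⬝ᵥ vecLift m x := by
    simpa using h.coneLE_vecMul hcone hw0 x hx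
  have hwx : 0 ≤ w ⬝ᵥ vecLift m x := by simpa using hw0 x hx
  rw [add_dotProduct, smul_dotProduct, smul_eq_mul, ← ENNReal.ofReal_le_ofReal_iff hwx,
    ENNReal.ofReal_add (by positivity) hwB,
    h.weightedLift_renewal hm hcone measurable_const (fun _ => zero_le_one) hint hx]
  refine add_le_add ?_ (le_of_eq ?_)
  · calc ENNReal.ofReal (κ * ℓ * (u ⬝ᵥ vecLift m x))
        = ∫⁻ ω, ENNReal.ofReal (κ * (u ⬝ᵥ vecLift m x) * min (R ω : ℝ) ε) ∂P := by
          rw [← ofReal_integral_eq_lintegral_ofReal (hℓint.const_mul _)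
            (Filter.Eventually.of_forall fun ω =>
              mul_nonneg (mul_nonneg hκ.le hux) (hmin0 ω)), integral_const_mul]
          congr 1
          ring
      _ ≤ _ := by
          refine lintegral_mono_ae ?_
          filter_upwards [hcone x hx] with ω hω
          calc ENNReal.ofReal (κ * (u ⬝ᵥ vecLift m x) * min (R ω : ℝ) ε)
              = ∫⁻ t in Set.Ioc 0 (min (R ω : ℝ) ε), ENNReal.ofReal (κ * (u ⬝ᵥ vecLift m x)) := by
                rw [setLIntegral_const, Real.volume_Ioc, sub_zero,
                  ENNReal.ofReal_mul (mul_nonneg hκ.le hux)]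
            _ ≤ ∫⁻ t in Set.Ioc 0 (min (R ω : ℝ) ε), ENNReal.ofReal 1 *
                  ENNReal.ofReal (u ⬝ᵥ vecLift m (flow (coefficient A σ ω) t *ᵥ x)) := by
                refine setLIntegral_mono' measurableSet_Ioc fun t ht => ?_
                rw [ENNReal.ofReal_one, one_mul]
                refine ENNReal.ofReal_le_ofReal ?_
                have h1 := hhalf (coefficient A σ ω) (fun _ => h.bound _) t ht.1.le
                  (ht.2.trans (min_le_right _ _)) x
                have h2 := (hω t ht.1.le).norm_pow_le hm
                have h3 : ‖x‖ ^ m ≤ 2 ^ m * ‖flow (coefficient A σ ω) t *ᵥ x‖ ^ m := by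
                  rw [← mul_pow]
                  exact pow_le_pow_left₀ (norm_nonneg _) h1 m
                have h4 : u ⬝ᵥ vecLift m x ≤ (n + 1) * ‖x‖ ^ m := hx.le_norm_pow.trans (by
                  gcongr; linarith)
                rw [hκdef, ← div_eq_inv_mul, div_le_iff₀ (by positivity)]
                calc u ⬝ᵥ vecLift m x ≤ (n + 1) * ‖x‖ ^ m := h4
                  _ ≤ (n + 1) * (2 ^ m * ‖flow (coefficient A σ ω) t *ᵥ x‖ ^ m) := by gcongr
                  _ = ‖flow (coefficient A σ ω) t *ᵥ x‖ ^ m * (2 ^ m * (n + 1)) := by ring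
                  _ ≤ _ := mul_le_mul_of_nonneg_right h2 (by positivity)
            _ ≤ _ := lintegral_mono_set (Set.Ioc_subset_Ioc_right (min_le_left _ _))
  · exact (h.lintegral_weight_powerSum_add_epoch hm hcone (ρ := fun _ => 1)
      (fun _ => zero_le_one) hint hx).symm

end IsBoundedRegenerative

/-! ### Schur stability implies exponential mean stability -/

/-- The exponential weight `e^{βt}`, truncated at the time `τ`. -/
noncomputable def truncatedExp (β τ : ℝ) : ℝ → ℝ :=
  (Set.Iic τ).indicator fun t => Real.exp (β * t)

theorem truncatedExp_nonneg (β τ t : ℝ) : 0 ≤ truncatedExp β τ t :=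
  Set.indicator_nonneg (fun _ _ => (Real.exp_pos _).le) t

theorem truncatedExp_of_le (β : ℝ) {τ t : ℝ} (h : t ≤ τ) :
    truncatedExp β τ t = Real.exp (β * t) :=
  Set.indicator_of_mem (s := Set.Iic τ) h _

theorem truncatedExp_add_le {β τ r T : ℝ} (hβ : 0 ≤ β) (hr : 0 ≤ r) (hrT : r ≤ T) (t : ℝ) :
    truncatedExp β τ (t + r) ≤ Real.exp (β * T) * truncatedExp β τ t := by
  by_cases ht : t + r ≤ τ
  · rw [truncatedExp_of_le β ht, truncatedExp_of_le β (by linarith), ← Real.exp_add]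
    refine Real.exp_le_exp.2 ?_
    nlinarith
  · have : truncatedExp β τ (t + r) = 0 := Set.indicator_of_notMem (s := Set.Iic τ) ht _
    rw [this]
    exact mul_nonneg (Real.exp_pos _).le (truncatedExp_nonneg β τ t)

namespace IsBoundedRegenerative

theorem integrableOn_truncatedExp_mul_meanLift (h : IsBoundedRegenerative P A C σ R T) (β τ : ℝ)
    (α γ : Exponent n m) :
    IntegrableOn (fun t => truncatedExp β τ t * meanLift P A σ m t α γ) (Set.Ioi 0) := by
  have heq : (fun t => truncatedExp β τ t * meanLift P A σ m t α γ) =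
      (Set.Iic τ).indicator fun t => Real.exp (β * t) * meanLift P A σ m t α γ := by
    funext t
    simp only [truncatedExp, Set.indicator_apply, ite_mul, zero_mul]
  rw [heq, IntegrableOn, integrable_indicator_iff measurableSet_Iic, IntegrableOn,
    Measure.restrict_restrict measurableSet_Iic, Set.inter_comm, Set.Ioi_inter_Iic]
  obtain ⟨D, hD⟩ := exists_abs_matLift_le_of_abs_le (Real.exp_pos (n * C * τ)).le α γ
  refine Measure.integrableOn_of_bounded (M := Real.exp (|β| * τ) * D) (by simp) ?_ ?_
  · exact ((by fun_prop : Measurable fun t => Real.exp (β * t)).mul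
      (h.measurable_meanLift α γ)).aestronglyMeasurable
  · filter_upwards [ae_restrict_mem measurableSet_Ioc] with t ht
    rw [norm_mul, Real.norm_eq_abs, abs_of_pos (Real.exp_pos _)]
    have h1 : ‖meanLift P A σ m t α γ‖ ≤ D := by
      have := norm_integral_le_of_norm_le_const (μ := P) (C := D)
        (f := fun ω => matLift m (flow (coefficient A σ ω) t) α γ)
        (Filter.Eventually.of_forall fun ω => hD _ fun i j =>
          abs_flow_le_of_le (fun _ => h.bound _) ht.1.le ht.2 i j)
      simpa [meanLift] using this
    refine mul_le_mul (Real.exp_le_exp.2 ?_) h1 (norm_nonneg _) (Real.exp_pos _).le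
    calc β * t ≤ |β| * t := mul_le_mul_of_nonneg_right (le_abs_self β) ht.1.le
      _ ≤ |β| * τ := mul_le_mul_of_nonneg_left ht.2 (abs_nonneg β)

/-- The truncated exponential moments satisfy the renewal inequality
`w ≤ c ∑ xᵢ^m + e^{βT} (w ∘ B)`, with `c` independent of the truncation. -/
theorem exists_coneLE_truncatedExp (h : IsBoundedRegenerative P A C σ R T) (hm : 0 < m)
    (hcone : PreservesCone P A σ m) {β : ℝ} (hβ : 0 ≤ β) :
    ∃ c : ℝ, 0 ≤ c ∧ ∀ τ : ℝ,
      ConeLE (powerSumCovector n m ᵥ* weightedLift P A σ m (truncatedExp β τ))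
        (c • powerSumCovector n m + Real.exp (β * T) •
          (powerSumCovector n m ᵥ* weightedLift P A σ m (truncatedExp β τ) ᵥ*
            expectedLift P A σ R m)) := by
  set u := powerSumCovector n m with hu
  set κ : ℝ := Real.exp (β * T) * (n * (n * Real.exp (n * C * T)) ^ m) with hκ
  have hκ0 : 0 ≤ κ := by positivity
  refine ⟨κ * T, by positivity, fun τ x hx => ?_⟩
  set ρ := truncatedExp β τ with hρ
  have hρ0 : ∀ t, 0 ≤ ρ t := truncatedExp_nonneg β τ
  have hρm : Measurable ρ := (by fun_prop : Measurable fun t => Real.exp (β * t)).indicator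
    measurableSet_Iic
  have hint := fun α γ : Exponent n m => h.integrableOn_truncatedExp_mul_meanLift β τ α γ
  set w := u ᵥ* weightedLift P A σ m ρ with hwdef
  have hux : 0 ≤ u ⬝ᵥ vecLift m x := by simpa using coneLE_zero_powerSum hm x hx
  have hwB : 0 ≤ (w ᵥ* expectedLift P A σ R m) ⬝ᵥ vecLift m x := by
    have := h.coneLE_vecMul hcone (h.coneLE_zero_weightedLift hm hcone hρ0 hint) x hx
    rwa [Matrix.zero_vecMul, zero_dotProduct] at this
  have hE := (Real.exp_pos (β * T)).le
  have h1 : 0 ≤ κ * T * (u ⬝ᵥ vecLift m x) := mul_nonneg (by positivity) hux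
  have h2 := mul_nonneg hE hwB
  rw [add_dotProduct, smul_dotProduct, smul_dotProduct, smul_eq_mul, smul_eq_mul,
    ← ENNReal.ofReal_le_ofReal_iff (add_nonneg h1 h2), ENNReal.ofReal_add h1 h2,
    h.weightedLift_renewal hm hcone hρm hρ0 hint hx]
  refine add_le_add ?_ ?_
  · calc _ ≤ ∫⁻ _ω, ENNReal.ofReal (κ * T * (u ⬝ᵥ vecLift m x)) ∂P := by
          refine lintegral_mono_ae ?_
          filter_upwards [hcone x hx, h.epoch_le] with ω hω hT
          have hT' : (R ω : ℝ) ≤ T := hT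
          calc _ ≤ ∫⁻ _t in Set.Ioc 0 (R ω : ℝ), ENNReal.ofReal (κ * (u ⬝ᵥ vecLift m x)) := by
                refine setLIntegral_mono' measurableSet_Ioc fun t ht => ?_
                have htT : t ≤ T := ht.2.trans hT'
                have h1 : ρ t ≤ Real.exp (β * T) := by
                  refine (Set.indicator_le_self' (fun _ _ => (Real.exp_pos _).le) t).trans ?_
                  exact Real.exp_le_exp.2 (mul_le_mul_of_nonneg_left htT hβ)
                have h2 : ‖flow (coefficient A σ ω) t *ᵥ x‖ ≤
                    n * Real.exp (n * C * T) * ‖x‖ :=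
                  norm_mulVec_le (Real.exp_pos _).le
                    (fun i j => abs_flow_le_of_le (fun _ => h.bound _) ht.1.le htT i j) x
                have h3 : u ⬝ᵥ vecLift m (flow (coefficient A σ ω) t *ᵥ x) ≤
                    n * (n * Real.exp (n * C * T)) ^ m * (u ⬝ᵥ vecLift m x) := by
                  refine (hω t ht.1.le).le_norm_pow.trans ?_
                  rw [mul_assoc]
                  refine mul_le_mul_of_nonneg_left ?_ (Nat.cast_nonneg n)
                  refine (pow_le_pow_left₀ (norm_nonneg _) h2 m).trans ?_
                  rw [mul_pow]
                  exact mul_le_mul_of_nonneg_left (hx.norm_pow_le hm) (by positivity)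
                rw [← ENNReal.ofReal_mul (hρ0 t)]
                refine ENNReal.ofReal_le_ofReal ?_
                rw [hκ, mul_assoc (Real.exp (β * T))]
                refine mul_le_mul h1 h3 ?_ (Real.exp_pos _).le
                simpa using coneLE_zero_powerSum hm _ (hω t ht.1.le)
            _ ≤ ENNReal.ofReal (κ * T * (u ⬝ᵥ vecLift m x)) := by
                rw [setLIntegral_const, Real.volume_Ioc, sub_zero,
                  ← ENNReal.ofReal_mul (mul_nonneg hκ0 hux), mul_right_comm κ]
                exact ENNReal.ofReal_le_ofReal (mul_le_mul_of_nonneg_right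
                  (mul_le_mul_of_nonneg_left hT' hκ0) hux)
      _ = _ := by simp
  · rw [ENNReal.ofReal_mul hE, ← h.lintegral_weight_powerSum_add_epoch hm hcone hρ0 hint hx,
      ← lintegral_const_mul' _ _ ENNReal.ofReal_ne_top]
    refine lintegral_mono fun t => ?_
    rw [← lintegral_const_mul' _ _ ENNReal.ofReal_ne_top]
    refine lintegral_mono_ae ?_
    filter_upwards [h.epoch_le] with ω hT
    have hT' : (R ω : ℝ) ≤ T := hT
    rw [← mul_assoc, ← ENNReal.ofReal_mul hE]
    refine mul_le_mul_left (ENNReal.ofReal_le_ofReal ?_) _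
    exact truncatedExp_add_le hβ (R ω).coe_nonneg hT' t

/-- Over a short time the norm of the state can drop at most by the factor two, so that a pointwise
bound of the moments follows from a bound of their exponentially weighted integral. -/
theorem exists_lintegral_norm_pow_le (h : IsBoundedRegenerative P A C σ R T) (hm : 0 < m)
    (hcone : PreservesCone P A σ m) (hS : IsSchurStable (expectedLift P A σ R m)) :
    ∃ K : ℝ, 0 ≤ K ∧ ∃ β : ℝ, 0 < β ∧ ∀ x : Fin n → ℝ, InCone m x → ∀ t, 0 ≤ t →
      ∫⁻ ω, ENNReal.ofReal (‖flow (coefficient A σ ω) t *ᵥ x‖ ^ m) ∂P ≤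
        ENNReal.ofReal (K * Real.exp (-β * t) * ‖x‖ ^ m) := by
  obtain ⟨r, hr0, hr1, D, hD, hpow⟩ := hS.exists_abs_pow_le
  have hlog : Real.log r < 0 := Real.log_neg hr0 hr1
  have hT1 : (0 : ℝ) < T + 1 := by positivity
  set β : ℝ := -Real.log r / (T + 1) with hβdef
  have hβ : 0 < β := div_pos (neg_pos.2 hlog) hT1
  have her : Real.exp (β * T) * r < 1 := by
    have h1 : Real.exp (β * T) * r = Real.exp (β * T + Real.log r) := by
      rw [Real.exp_add, Real.exp_log hr0]
    rw [h1, Real.exp_lt_one_iff]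
    have : β * (T + 1) = -Real.log r := div_mul_cancel₀ _ hT1.ne'
    linarith
  obtain ⟨c, hc, hren⟩ := h.exists_coneLE_truncatedExp hm hcone hβ.le
  obtain ⟨K, hK⟩ := exists_bound_of_coneLE (fun v w => h.coneLE_vecMul hcone)
    (Real.exp_pos (β * T)).le hr0.le her hpow hc
  obtain ⟨ε, hε, hhalf⟩ := exists_norm_le_two_mul_norm_flow n C
  refine ⟨2 ^ m * |K| / ε, by positivity, β, hβ, fun x hx t ht => ?_⟩
  set Q : ℝ → ℝ≥0∞ := fun s =>
    ∫⁻ ω, ENNReal.ofReal (‖flow (coefficient A σ ω) s *ᵥ x‖ ^ m) ∂P with hQ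
  have hstep : ∀ s ∈ Set.Ioc t (t + ε), Q t ≤ ENNReal.ofReal (2 ^ m) * Q s := by
    intro s hs
    rw [hQ, ← lintegral_const_mul' _ _ ENNReal.ofReal_ne_top]
    refine lintegral_mono fun ω => ?_
    rw [← ENNReal.ofReal_mul (by positivity), ← mul_pow]
    refine ENNReal.ofReal_le_ofReal (pow_le_pow_left₀ (norm_nonneg _) ?_ m)
    have hpath := measurable_coefficient_path h.measurable_matrix h.measurable_process ω
    have hadd := flow_add hpath (fun _ => h.bound _) ht (sub_nonneg.2 hs.1.le)
      (b := fun s => coefficient A σ ω (s + t))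
      (fun i j => (hpath i j).comp (measurable_add_const t)) (fun _ => h.bound _)
      fun s _ => rfl
    rw [sub_add_cancel] at hadd
    rw [hadd, ← Matrix.mulVec_mulVec]
    exact hhalf _ (fun _ => h.bound _) (s - t) (sub_nonneg.2 hs.1.le) (by linarith [hs.2]) _
  have hmain : ENNReal.ofReal (Real.exp (β * t)) * Q t * ENNReal.ofReal ε ≤
      ENNReal.ofReal (2 ^ m * (|K| * ‖x‖ ^ m)) := by
    calc ENNReal.ofReal (Real.exp (β * t)) * Q t * ENNReal.ofReal ε
        = ∫⁻ _s in Set.Ioc t (t + ε), ENNReal.ofReal (Real.exp (β * t)) * Q t := by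
          rw [setLIntegral_const, Real.volume_Ioc, add_sub_cancel_left]
      _ ≤ ∫⁻ s in Set.Ioc t (t + ε), ENNReal.ofReal (2 ^ m) *
            ∫⁻ ω, ENNReal.ofReal (truncatedExp β (t + ε) s) * ENNReal.ofReal
              (powerSumCovector n m ⬝ᵥ vecLift m (flow (coefficient A σ ω) s *ᵥ x)) ∂P := by
          refine setLIntegral_mono' measurableSet_Ioc fun s hs => ?_
          rw [truncatedExp_of_le β hs.2,
            lintegral_const_mul' _ _ ENNReal.ofReal_ne_top, mul_left_comm]
          refine mul_le_mul' (ENNReal.ofReal_le_ofReal (Real.exp_le_exp.2 ?_))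
            ((hstep s hs).trans (mul_le_mul_right (lintegral_mono_ae ?_) _))
          · exact mul_le_mul_of_nonneg_left hs.1.le hβ.le
          · filter_upwards [hcone x hx] with ω hω
            exact ENNReal.ofReal_le_ofReal ((hω s (ht.trans hs.1.le)).norm_pow_le hm)
      _ ≤ ∫⁻ s in Set.Ioi 0, ENNReal.ofReal (2 ^ m) *
            ∫⁻ ω, ENNReal.ofReal (truncatedExp β (t + ε) s) * ENNReal.ofReal
              (powerSumCovector n m ⬝ᵥ vecLift m (flow (coefficient A σ ω) s *ᵥ x)) ∂P :=
          lintegral_mono_set fun s hs => ht.trans_lt hs.1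
      _ = ENNReal.ofReal (2 ^ m) * ENNReal.ofReal ((powerSumCovector n m ᵥ*
            weightedLift P A σ m (truncatedExp β (t + ε))) ⬝ᵥ vecLift m x) := by
          rw [lintegral_const_mul' _ _ ENNReal.ofReal_ne_top,
            h.lintegral_weight_powerSum hm hcone (truncatedExp_nonneg β _)
              (h.integrableOn_truncatedExp_mul_meanLift β _) hx]
      _ ≤ ENNReal.ofReal (2 ^ m * (|K| * ‖x‖ ^ m)) := by
          rw [ENNReal.ofReal_mul (by positivity)]
          refine mul_le_mul_right (ENNReal.ofReal_le_ofReal ?_) _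
          refine (hK _ (hren (t + ε)) x hx).trans ?_
          exact mul_le_mul_of_nonneg_right (le_abs_self K) (by positivity)
  have hprod : 0 < Real.exp (β * t) * ε := mul_pos (Real.exp_pos _) hε
  have hval : 2 ^ m * |K| / ε * Real.exp (-β * t) * ‖x‖ ^ m =
      2 ^ m * (|K| * ‖x‖ ^ m) / (Real.exp (β * t) * ε) := by
    rw [neg_mul, Real.exp_neg]
    field_simp
  rw [hval, ENNReal.ofReal_div_of_pos hprod, ENNReal.le_div_iff_mul_le
    (Or.inl (ENNReal.ofReal_pos.2 hprod).ne') (Or.inl ENNReal.ofReal_ne_top),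
    ENNReal.ofReal_mul (Real.exp_pos _).le, ← mul_assoc, mul_comm (Q t)]
  exact hmain

theorem isExpMeanStable (h : IsBoundedRegenerative P A C σ R T) (hm : 0 < m)
    (hcone : PreservesCone P A σ m) (hS : IsSchurStable (expectedLift P A σ R m)) :
    IsExpMeanStable P A σ m := by
  obtain ⟨K, hK, β, hβ, hbd⟩ := h.exists_lintegral_norm_pow_le hm hcone hS
  refine ⟨n ^ m * 2 ^ m * (2 * K) + 1, by positivity, β, hβ, fun x t ht => ?_⟩
  -- Arbitrary initial states are differences of nonnegative ones, which lie in the cone.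
  set y : Fin n → ℝ := fun i => max (x i) 0 with hy
  set z : Fin n → ℝ := fun i => max (-x i) 0 with hz
  have hxyz : x = y - z := by
    funext i
    simp only [hy, hz, Pi.sub_apply]
    rcases le_total (x i) 0 with hi | hi
    · rw [max_eq_right hi, max_eq_left (neg_nonneg.2 hi)]; ring
    · rw [max_eq_left hi, max_eq_right (neg_nonpos.2 hi)]; ring
  have hyn : ‖y‖ ≤ ‖x‖ := (pi_norm_le_iff_of_nonneg (norm_nonneg _)).2 fun i => by
    rw [Real.norm_eq_abs, abs_of_nonneg (le_max_right _ _)]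
    exact max_le ((le_abs_self _).trans (norm_le_pi_norm x i)) (norm_nonneg _)
  have hzn : ‖z‖ ≤ ‖x‖ := (pi_norm_le_iff_of_nonneg (norm_nonneg _)).2 fun i => by
    rw [Real.norm_eq_abs, abs_of_nonneg (le_max_right _ _)]
    exact max_le ((neg_le_abs _).trans (norm_le_pi_norm x i)) (norm_nonneg _)
  have hyc : InCone m y := Or.inr fun i => le_max_right _ _
  have hzc : InCone m z := Or.inr fun i => le_max_right _ _
  have hE := (Real.exp_pos (-β * t)).le
  have hpt : ∀ ω, ‖WithLp.toLp 2 (state A σ x t ω)‖ ^ m ≤ n ^ m * 2 ^ m *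
      (‖flow (coefficient A σ ω) t *ᵥ y‖ ^ m + ‖flow (coefficient A σ ω) t *ᵥ z‖ ^ m) := by
    intro ω
    rw [state_eq h.measurable_matrix h.bound h.measurable_process x ht, mul_assoc]
    refine (pow_le_pow_left₀ (norm_nonneg _) (norm_toLp_le _) m).trans ?_
    rw [mul_pow]
    refine mul_le_mul_of_nonneg_left ?_ (by positivity)
    have h1 : ‖flow (coefficient A σ ω) t *ᵥ x‖ ≤
        ‖flow (coefficient A σ ω) t *ᵥ y‖ + ‖flow (coefficient A σ ω) t *ᵥ z‖ := by
      rw [hxyz, Matrix.mulVec_sub]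
      exact norm_sub_le _ _
    refine (pow_le_pow_left₀ (norm_nonneg _) h1 m).trans ?_
    refine (add_pow_le (norm_nonneg _) (norm_nonneg _) m).trans ?_
    refine mul_le_mul_of_nonneg_right ?_ (by positivity)
    exact pow_le_pow_right₀ one_le_two (Nat.sub_le m 1)
  have hmeas : ∀ x : Fin n → ℝ, Measurable fun ω =>
      ENNReal.ofReal (‖flow (coefficient A σ ω) t *ᵥ x‖ ^ m) := fun x =>
    ((((h.measurable_flow_mulVec x).comp (measurable_const.prodMk
      measurable_id)).norm.pow_const m).ennreal_ofReal :)
  have hle : ∀ v : Fin n → ℝ, InCone m v → ‖v‖ ≤ ‖x‖ →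
      ∫⁻ ω, ENNReal.ofReal (‖flow (coefficient A σ ω) t *ᵥ v‖ ^ m) ∂P ≤
        ENNReal.ofReal (K * Real.exp (-β * t) * ‖x‖ ^ m) := fun v hv hvx =>
    (hbd v hv t ht).trans (ENNReal.ofReal_le_ofReal (by gcongr))
  calc moment P A σ m x t ≤ ∫⁻ ω, ENNReal.ofReal (n ^ m * 2 ^ m) *
          (ENNReal.ofReal (‖flow (coefficient A σ ω) t *ᵥ y‖ ^ m) +
            ENNReal.ofReal (‖flow (coefficient A σ ω) t *ᵥ z‖ ^ m)) ∂P := by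
        refine lintegral_mono fun ω => (ENNReal.ofReal_le_ofReal (hpt ω)).trans (le_of_eq ?_)
        rw [ENNReal.ofReal_mul (by positivity), ENNReal.ofReal_add (by positivity)
          (by positivity)]
    _ ≤ ENNReal.ofReal (n ^ m * 2 ^ m) * (ENNReal.ofReal (K * Real.exp (-β * t) * ‖x‖ ^ m) +
          ENNReal.ofReal (K * Real.exp (-β * t) * ‖x‖ ^ m)) := by
        rw [lintegral_const_mul' _ _ ENNReal.ofReal_ne_top, lintegral_add_left (hmeas y)]
        exact mul_le_mul_right (add_le_add (hle y hyc hyn) (hle z hzc hzn)) _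
    _ = ENNReal.ofReal (n ^ m * 2 ^ m * (2 * K) * Real.exp (-β * t) * ‖x‖ ^ m) := by
        rw [← ENNReal.ofReal_add (by positivity) (by positivity),
          ← ENNReal.ofReal_mul (by positivity)]
        congr 1
        ring
    _ ≤ _ := by
        refine ENNReal.ofReal_le_ofReal ?_
        have := norm_le_norm_toLp x
        gcongr
        linarith

end IsBoundedRegenerative

theorem IsExpMeanStable.isStochMeanStable {Ω S : Type*} [MeasurableSpace Ω] {P : Measure Ω}
    {n m : ℕ} {A : S → Matrix (Fin n) (Fin n) ℝ} {σ : ℝ≥0 → Ω → S}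
    (h : IsExpMeanStable P A σ m) : IsStochMeanStable P A σ m := by
  obtain ⟨α, hα, β, hβ, hle⟩ := h
  intro x
  have hint : IntegrableOn (fun t => α * Real.exp (-β * t) * ‖WithLp.toLp 2 x‖ ^ m)
      (Set.Ioi 0) := ((exp_neg_integrableOn_Ioi 0 hβ).const_mul α).mul_const _
  refine lt_of_le_of_lt (setLIntegral_mono' measurableSet_Ioi fun t (ht : 0 < t) =>
    hle x t ht.le) ?_
  exact hint.lintegral_lt_top

end Stability

end RegenerativeSwitching

theorem theorem1 {Ω S : Type*} [MeasurableSpace Ω] [MeasurableSpace S]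
    (P : Measure Ω) [IsProbabilityMeasure P]
    -- the switched system: a measurable process and a bounded measurable family of matrices
    {n : ℕ} (A : S → Matrix (Fin n) (Fin n) ℝ) (hA : ∀ i j, Measurable fun s => A s i j)
    (hAbdd : ∃ C : ℝ, ∀ s i j, |A s i j| ≤ C)
    (σ : ℝ≥0 → Ω → S) (hσ : Measurable fun p : ℝ≥0 × Ω => σ p.1 p.2)
    -- the process is regenerative, with an essentially bounded epoch
    (R : Ω → ℝ≥0) (hR : RegenerativeSwitching.IsRegenerationEpoch P σ R)
    (hRbdd : ∃ T : ℝ≥0, ∀ᵐ ω ∂P, R ω ≤ T)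
    (m : ℕ) (hm : 0 < m)
    (hmA : Even m ∨ RegenerativeSwitching.IsPositiveSystem P A σ) :
    (∀ α β, Integrable (fun ω => RegenerativeSwitching.matLift m
        (RegenerativeSwitching.firstCycleMatrix A σ R ω) α β) P) ∧
    List.TFAE
      [RegenerativeSwitching.IsExpMeanStable P A σ m,
       RegenerativeSwitching.IsStochMeanStable P A σ m,
       RegenerativeSwitching.IsSchurStable (RegenerativeSwitching.expectedLift P A σ R m)] := by
  obtain ⟨C, hC⟩ := hAbdd
  obtain ⟨T, hT⟩ := hRbdd
  have h : RegenerativeSwitching.IsBoundedRegenerative P A C σ R T := ⟨hA, hC, hσ, hR, hT⟩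
  have hcone := h.preservesCone hmA
  refine ⟨fun α β => ?_, ?_⟩
  · simp only [RegenerativeSwitching.firstCycleMatrix_eq hA hC hσ]
    exact h.integrable_matLift_epoch α β
  · tfae_have 1 → 2 := fun h1 => h1.isStochMeanStable
    tfae_have 2 → 3 := h.isSchurStable hm hcone
    tfae_have 3 → 1 := h.isExpMeanStable hm hcone
    tfae_finish
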